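/- **Setting.** Let $n,m\ge 1$. There are $n$ firms and $m$ markets. Firm $i$ chooses $\mathbf s_i=(s_{ix})_{x=1}^m\in\Delta=\{\mathbf v\in\mathbb R^m:\mathbf v\ge 0,\ \sum_x v_x=1\}$; write $\mathbf S=(\mathbf s_i)_{i=1}^n\in\Delta^n$, $\mathbf s=\sum_i\mathbf s_i$ with coordinates $s_x=\sum_i s_{ix}$, and $\bar{\mathbf S}=(\mathbf s/n)_{i=1}^n$. The payoff of firm $i$ is $$u_i(\mathbf S)=\sum_{x=1}^m \frac{u_x(s_x)}{s_x}\,s_{ix}-c(\mathbf s_i)$$ (a market with $s_x=0$ contributes $0$). Assume that each $u_x:\mathbb R_{\ge0}\to\mathbb R_{\ge0}$ is concave with $u_x(0)=0$ and is continuously differentiable on $[0,\infty)$ (one-sidedly at $0$); that $c:\Delta\to\mathbb R_{\ge0}$ is convex and quadratic, i.e. a polynomial of degree at most $2$; and that either all but at most one of the $u_x$ are strictly concave, or $c$ is strictly convex. The gradient adjustment process is $$\frac{d\mathbf s_i}{dt}=P_{T(\mathbf s_i)}\nabla_i u_i(\mathbf S),\qquad i=1,\dots,n,$$ where $\nabla_i$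 is the gradient with respect to $\mathbf s_i$ (with one-sided partial derivatives where $s_{ix}=0$), $T(\mathbf s_i)$ is the tangent cone of $\Delta$ at $\mathbf s_i$, and $P$ is the Euclidean projection. A trajectory is a locally absolutely continuous curve $\mathbf S:[0,\infty)\to\Delta^n$ that satisfies this equation for almost every $t\ge 0$. **Theorem.** The game has exactly one pure-strategy Nash equilibrium $\mathbf S^*$, and $\mathbf S^*$ is globally asymptotically stable under the gradient adjustment process on $\Delta^n$: from every point of $\Delta^n$ a trajectory starts; for every $\varepsilon>0$ there is $\delta>0$ such that every trajectory starting within distance $\delta$ of $\mathbf S^*$ stays within distance $\varepsilon$ of $\mathbf S^*$ for all $t\ge0$; and every trajectory converges to $\mathbf S^*$ as $t\to\infty$. Moreover, let $\mathbf s^*=\sum_i\mathbf s^*_i$, $$\Phi(\mathbf s)=\sum_{x=1}^m\Big[\Big(1-\frac1n\Big)\int_0^{s_x}\frac{u_x(t)}{t}\,dt+\frac1n u_x(s_x)\Big]-n\,c(\mathbf s/n),\qquad V(\mathbf S)=\Phi(\mathbf s^*)-\Phi(\mathbf s)+\|\mathbf S-\bar{\mathbf S}\|^2 .$$ Then $V$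 is continuously differentiable on $\Delta^n$, $V(\mathbf S^*)=0$, $V(\mathbf S)>0$ for all $\mathbf S\in\Delta^n\setminus\{\mathbf S^*\}$, and the derivative of $V$ along the gradient adjustment process is negative at every $\mathbf S\ne\mathbf S^*$ in the relative interior of $\Delta^n$ (all $s_{ix}>0$). -/

import Mathlib

open Set Filter Topology MeasureTheory

noncomputable section

namespace Oligopoly

/-- A strategy of one firm: the amounts of resource it puts into the `m` markets, with the Euclidean
norm. Admissible strategies are the points of `simplex m`. -/
abbrev Strat (m : ℕ) : Type := EuclideanSpace ℝ (Fin m)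

/-- A strategy profile: one strategy for each of the `n` firms. -/
abbrev Profile (n m : ℕ) : Type := Fin n → Strat m

/-- The unit simplex, the strategy space of each firm. -/
def simplex (m : ℕ) : Set (Strat m) := {v | (∀ x, 0 ≤ v x) ∧ ∑ x, v x = 1}

/-- The space of admissible strategy profiles. -/
def profiles (n m : ℕ) : Set (Profile n m) := {S | ∀ i, S i ∈ simplex m}

/-- Data of a multi-market oligopoly with `m` markets: the production functions `u x` (only their
values on `[0, ∞)` matter) and the cost function `c` common to all firms. -/
structure Market (m : ℕ) where
  u : Fin m → ℝ → ℝ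
  c : Strat m → ℝ

/-- Standing assumptions on the game: on `[0, ∞)` each production function is nonnegative, concave
and differentiable (one-sidedly at `0`) and vanishes at `0`; on the simplex the cost is nonnegative,
convex and differentiable; all but at most one production function are strictly concave, or the cost
is strictly convex. -/
structure Market.Standing {m : ℕ} (g : Market m) : Prop where
  u_zero : ∀ x, g.u x 0 = 0
  u_nonneg : ∀ x, ∀ t, 0 ≤ t → 0 ≤ g.u x t
  u_concave : ∀ x, ConcaveOn ℝ (Ici 0) (g.u x)
  u_diff : ∀ x, DifferentiableOn ℝ (g.u x) (Ici 0)
  c_nonneg : ∀ v ∈ simplex m, 0 ≤ g.c v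
  c_convex : ConvexOn ℝ (simplex m) g.c
  c_diff : DifferentiableOn ℝ g.c (simplex m)
  strict : (∃ y, ∀ x, x ≠ y → StrictConcaveOn ℝ (Ici 0) (g.u x)) ∨
    StrictConvexOn ℝ (simplex m) g.c

/-- Additional assumptions for the dynamics: each production function is continuously differentiable
on `[0, ∞)`, and the cost is a polynomial of degree at most two. -/
structure Market.Smooth {m : ℕ} (g : Market m) : Prop where
  u_contDiff : ∀ x, ContDiffOn ℝ 1 (g.u x) (Ici 0)
  c_quadratic : ∃ (A : Matrix (Fin m) (Fin m) ℝ) (b : Fin m → ℝ) (k : ℝ), ∀ v : Strat m,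
    g.c v = (1 / 2) * ∑ x, ∑ y, A x y * v x * v y + ∑ x, b x * v x + k

/-- The aggregate strategy `s`, the sum of the strategies of all firms. -/
def agg {n m : ℕ} (S : Profile n m) : Strat m := ∑ i, S i

/-- The symmetrized profile, in which every firm plays the average strategy `s / n`. -/
def symm {n m : ℕ} (S : Profile n m) : Profile n m := fun _ => (n : ℝ)⁻¹ • agg S

/-- Payoff of firm `i`: revenue shared proportionally to the allocation, minus the cost. In a market
with `agg S x = 0` the firm has `S i x = 0` and gets no revenue. -/
def payoff {n m : ℕ} (g : Market m) (i : Fin n) (S : Profile n m) : ℝ :=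
  ∑ x, g.u x (agg S x) / agg S x * S i x - g.c (S i)

/-- Pure-strategy Nash equilibrium. -/
def IsNash {n m : ℕ} (g : Market m) (S : Profile n m) : Prop :=
  S ∈ profiles n m ∧
    ∀ i, ∀ v ∈ simplex m, payoff g i (Function.update S i v) ≤ payoff g i S

/-- The gradient of the payoff of firm `i` in its own strategy; the partial derivatives are taken
with allocations restricted to `[0, ∞)`, so they are one-sided at `0`. -/
def gradPayoff {n m : ℕ} (g : Market m) (i : Fin n) (S : Profile n m) : Strat m :=
  WithLp.toLp 2 fun x => derivWithin
    (fun t : ℝ => payoff g i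
      (Function.update S i (WithLp.toLp 2 (Function.update (S i).ofLp x t)))) (Ici 0) (S i x)

/-- `w` is a point of `K` nearest to `v` in the Euclidean norm. -/
def IsNearest {m : ℕ} (K : Set (Strat m)) (v w : Strat m) : Prop :=
  w ∈ K ∧ ∀ z ∈ K, ‖v - w‖ ≤ ‖v - z‖

/-- Projection onto `K`. It is used only for tangent cones of the simplex, where the nearest point
exists and is unique, see `isNearest_proj` and `isNearest_unique`. -/
def proj {m : ℕ} (K : Set (Strat m)) (v : Strat m) : Strat m :=
  Classical.epsilon (IsNearest K v)

/-- The tangent cone of the simplex at `v`. -/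
def tangentCone {m : ℕ} (v : Strat m) : Set (Strat m) := posTangentConeAt (simplex m) v

/-- Velocity of the gradient adjustment process: each firm follows the gradient of its own payoff,
projected onto the tangent cone of its strategy space. -/
def velocity {n m : ℕ} (g : Market m) (S : Profile n m) : Profile n m :=
  fun i => proj (tangentCone (S i)) (gradPayoff g i S)

/-- A trajectory of the gradient adjustment process on `[0, ∞)`: a locally absolutely continuous
curve of admissible profiles that satisfies the differential equation at almost every time (the
velocity is discontinuous where the curve meets the boundary of the simplex). -/
structure IsTrajectory {n m : ℕ} (g : Market m) (S : ℝ → Profile n m) : Prop where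
  mem : ∀ t, 0 ≤ t → S t ∈ profiles n m
  absCont : ∀ T, 0 ≤ T → AbsolutelyContinuousOnInterval S 0 T
  ode : ∀ᵐ t ∂(volume.restrict (Ici (0 : ℝ))), HasDerivAt S (velocity g (S t)) t

/-- Global asymptotic stability of `Sstar` under the gradient adjustment process on the whole
strategy space: trajectories exist from every initial profile, `Sstar` is Lyapunov stable, and
every trajectory converges to it. No uniqueness of trajectories is presupposed. -/
structure IsGloballyAsymptoticallyStable {n m : ℕ} (g : Market m) (Sstar : Profile n m) :
    Prop where
  mem : Sstar ∈ profiles n m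
  exists_trajectory : ∀ S₀ ∈ profiles n m, ∃ S : ℝ → Profile n m, IsTrajectory g S ∧ S 0 = S₀
  stable : ∀ ε > 0, ∃ δ > 0, ∀ S : ℝ → Profile n m, IsTrajectory g S →
    dist (S 0) Sstar < δ → ∀ t, 0 ≤ t → dist (S t) Sstar < ε
  attractive : ∀ S : ℝ → Profile n m, IsTrajectory g S → Tendsto S atTop (𝓝 Sstar)

/-- The potential function of an aggregate strategy, for `n` firms. -/
def potential {m : ℕ} (g : Market m) (n : ℕ) (s : Strat m) : ℝ :=
  ∑ x, ((1 - 1 / (n : ℝ)) * (∫ t in (0 : ℝ)..s x, g.u x t / t) + 1 / (n : ℝ) * g.u x (s x))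
    - n * g.c ((n : ℝ)⁻¹ • s)

/-- The function `V`: potential deficit relative to `Sstar`, plus the squared Euclidean norm (as a
vector with `n * m` entries) of the deviation of `S` from its symmetrization. -/
def lyapunov {n m : ℕ} (g : Market m) (Sstar S : Profile n m) : ℝ :=
  (potential g n (agg Sstar) - potential g n (agg S)) + ∑ i, ‖S i - symm S i‖ ^ 2

theorem mem_tangentCone_iff {m : ℕ} {v : Strat m} (hv : v ∈ simplex m) (w : Strat m) :
    w ∈ tangentCone v ↔ ∑ x, w x = 0 ∧ ∀ x, v x = 0 → 0 ≤ w x := by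
  constructor
  · intro h
    obtain ⟨α, l, hl, c, d, hd, hmem, hlim⟩ := exists_fun_of_mem_tangentConeAt h
    have hx : ∀ x, Tendsto (fun k => (c k • d k) x) l (𝓝 (w x)) := fun x =>
      ((EuclideanSpace.proj (𝕜 := ℝ) x).continuous.tendsto w).comp hlim
    have hval : ∀ k x, (c k • d k) x = (c k : ℝ) * d k x := fun k x => rfl
    refine ⟨?_, fun x hvx => ?_⟩
    · refine tendsto_nhds_unique (tendsto_finsetSum _ fun x _ => hx x) ?_
      refine tendsto_const_nhds.congr' ?_
      filter_upwards [hmem] with k hk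
      have h1 : ∑ x, (v + d k) x = 1 := hk.2
      have h2 : ∑ x, d k x = 0 := by
        simp only [PiLp.add_apply, Finset.sum_add_distrib, hv.2] at h1
        linarith
      simp only [hval, ← Finset.mul_sum, h2, mul_zero]
    · refine ge_of_tendsto (hx x) ?_
      filter_upwards [hmem] with k hk
      have h1 : 0 ≤ (v + d k) x := hk.1 x
      rw [PiLp.add_apply, hvx, zero_add] at h1
      rw [hval]
      exact mul_nonneg (c k).2 h1
  · rintro ⟨h0, hpos⟩
    refine mem_posTangentConeAt_of_frequently_mem (Eventually.frequently ?_)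
    have hev : ∀ x, ∀ᶠ t : ℝ in 𝓝[>] 0, 0 ≤ (v + t • w) x := by
      intro x
      rcases eq_or_lt_of_le (hv.1 x) with hx | hx
      · filter_upwards [self_mem_nhdsWithin] with t ht
        have ht' : (0 : ℝ) < t := ht
        simp only [PiLp.add_apply, PiLp.smul_apply, smul_eq_mul, ← hx, zero_add]
        exact mul_nonneg ht'.le (hpos x hx.symm)
      · have hc : Continuous fun t : ℝ => (v + t • w) x := by
          simp only [PiLp.add_apply, PiLp.smul_apply, smul_eq_mul]
          fun_prop
        have h1 : ∀ᶠ t : ℝ in 𝓝 0, 0 < (v + t • w) x :=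
          hc.tendsto 0 |>.eventually_const_lt (by simpa using hx)
        exact (h1.filter_mono nhdsWithin_le_nhds).mono fun t ht => ht.le
    filter_upwards [eventually_all.2 hev] with t ht
    refine ⟨ht, ?_⟩
    simp only [PiLp.add_apply, PiLp.smul_apply, smul_eq_mul, Finset.sum_add_distrib,
      ← Finset.mul_sum, h0, hv.2, mul_zero, add_zero]

theorem convex_tangentCone {m : ℕ} {v : Strat m} (hv : v ∈ simplex m) :
    Convex ℝ (tangentCone v) := by
  intro a ha b hb p q hp hq _
  rw [mem_tangentCone_iff hv] at ha hb ⊢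
  constructor
  · simp only [PiLp.add_apply, PiLp.smul_apply, smul_eq_mul, Finset.sum_add_distrib,
      ← Finset.mul_sum, ha.1, hb.1, mul_zero, add_zero]
  · intro x hx
    simp only [PiLp.add_apply, PiLp.smul_apply, smul_eq_mul]
    exact add_nonneg (mul_nonneg hp (ha.2 x hx)) (mul_nonneg hq (hb.2 x hx))

theorem isClosed_tangentCone {m : ℕ} {v : Strat m} (hv : v ∈ simplex m) :
    IsClosed (tangentCone v) := by
  have : tangentCone v = {w : Strat m | ∑ x, w x = 0} ∩ ⋂ x, ⋂ _ : v x = 0, {w | 0 ≤ w x} := by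
    ext w
    simp [mem_tangentCone_iff hv]
  rw [this]
  refine IsClosed.inter (isClosed_eq (by fun_prop) continuous_const) ?_
  exact isClosed_iInter fun x => isClosed_iInter fun _ =>
    isClosed_le continuous_const (by fun_prop)

/-- The projection onto a tangent cone of the simplex is a nearest point. -/
theorem isNearest_proj {m : ℕ} {v : Strat m} (hv : v ∈ simplex m) (f : Strat m) :
    IsNearest (tangentCone v) f (proj (tangentCone v) f) := by
  have hne : (tangentCone v).Nonempty := ⟨0, (mem_tangentCone_iff hv 0).2 (by simp)⟩
  obtain ⟨w, hw, h⟩ := exists_norm_eq_iInf_of_complete_convex hne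
    (isClosed_tangentCone hv).isComplete (convex_tangentCone hv) f
  refine Classical.epsilon_spec (p := IsNearest (tangentCone v) f) ⟨w, hw, fun z hz => ?_⟩
  rw [h]
  exact ciInf_le ⟨0, by rintro _ ⟨y, rfl⟩; exact norm_nonneg _⟩ (⟨z, hz⟩ : tangentCone v)

/-- Nearest points of a tangent cone of the simplex are unique. -/
theorem isNearest_unique {m : ℕ} {v : Strat m} (hv : v ∈ simplex m) {f w w' : Strat m}
    (h : IsNearest (tangentCone v) f w) (h' : IsNearest (tangentCone v) f w') : w = w' := by
  have hmid := h.2 _ (convex_tangentCone hv h.1 h'.1 (a := 1 / 2) (b := 1 / 2)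
    (by norm_num) (by norm_num) (by norm_num))
  have heq : ‖f - w‖ = ‖f - w'‖ := le_antisymm (h.2 _ h'.1) (h'.2 _ h.1)
  have hpar := parallelogram_law_with_norm ℝ (f - w) (f - w')
  have e1 : (f - w) + (f - w') = (2 : ℝ) • (f - ((1 / 2 : ℝ) • w + (1 / 2 : ℝ) • w')) := by
    module
  have e2 : (f - w) - (f - w') = w' - w := by abel
  rw [e1, e2, norm_smul, ← heq] at hpar
  norm_num at hpar hmid
  have h0 : ‖w' - w‖ = 0 := by
    nlinarith [norm_nonneg (w' - w), norm_nonneg (f - w),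
      mul_self_le_mul_self (norm_nonneg (f - w)) hmid]
  exact (sub_eq_zero.1 (norm_eq_zero.1 h0)).symm

end Oligopoly

end

/-! Write `d_i = s_i - s/n`. For a fixed aggregate `s` the revenue gradient of a firm is affine in
its own allocation, and so is the cost gradient, because `c` is quadratic. Therefore `∇_i u_i(S) =
∇Φ(s) + R_s d_i` (`gradPayoff_eq_response`), where the linear map `R_s`, the same for all firms, is
the diagonal matrix of the slopes of `u_x(t)/t` at `s_x` minus the Hessian of `c`. Concavity of
`u_x` makes `u_x(t)/t` nonincreasing, so `⟪R_s d_i, d_i⟫ ≤ 0`, and `Φ` is concave. The strictness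
assumption makes both strict, because a nonzero vector with coordinate sum zero cannot be supported
on the single market that may fail to be strictly concave.

Let `s*` maximize `Φ` and let every firm play `s*/n` in `S*`. Since `∑ d_i = 0`, cross terms cancel
and `∑ ⟪∇_i u_i, s_i - s*/n⟫ = ⟪∇Φ(s), s - s*⟫ + ∑ ⟪R_s d_i, d_i⟫` (`drift_eq`), which is negative
unless `S = S*` (`drift_neg`). At an equilibrium the first-order conditions make this sum
nonnegative, so no other equilibrium exists. `S*` is one because all its payoff gradients equal
`∇Φ(s*)` and payoffs are concave in the own strategy.

Projecting a gradient onto the tangent cone at `s_i` cannot increase its pairing with `s_i - s*/n`.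
Hence the squared distance to `S*` decreases along trajectories, also on the boundary. This
function, rather than `V`, gives stability and, by compactness, convergence (`stable_of_drift_neg`).
Trajectories are limits of projected Euler schemes (`exists_projected_solution`). In the interior
the projection is onto the zero-sum hyperplane, and the derivative of `V` is `-‖ds/dt‖²/n + 2 ∑ ⟪R_s
d_i, d_i⟫`. -/

noncomputable section

namespace Oligopoly

/-! ### Average and marginal values of a concave production function -/

/-- The marginal value of `u`, one-sided at `0`. -/
def marg (u : ℝ → ℝ) (t : ℝ) : ℝ := derivWithin u (Ici 0) t

/-- The average value `u t / t`, extended by the marginal value at `0`. -/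
def avg (u : ℝ → ℝ) (t : ℝ) : ℝ := if t = 0 then marg u 0 else u t / t

/-- The derivative `(u' - u / t) / t` of the average value. -/
def avgSlope (u : ℝ → ℝ) (t : ℝ) : ℝ := (marg u t - avg u t) / t

/-- Assumptions on a production function. -/
structure Production (u : ℝ → ℝ) : Prop where
  zero : u 0 = 0
  concave : ConcaveOn ℝ (Ici 0) u
  smooth : ContDiffOn ℝ 1 u (Ici 0)

namespace Production

variable {u : ℝ → ℝ} {s t : ℝ}

theorem hasDerivWithinAt (h : Production u) (hs : 0 ≤ s) :
    HasDerivWithinAt u (marg u s) (Ici 0) s :=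
  ((h.smooth.differentiableOn (by simp)) s hs).hasDerivWithinAt

theorem continuousOn_marg (h : Production u) : ContinuousOn (marg u) (Ici 0) :=
  h.smooth.continuousOn_derivWithin (uniqueDiffOn_Ici 0) le_rfl

theorem le_tangent (h : Production u) (hs : 0 ≤ s) (ht : 0 ≤ t) :
    u t ≤ u s + marg u s * (t - s) := by
  rcases lt_trichotomy s t with hst | rfl | hst
  · have := h.concave.slope_le_of_hasDerivWithinAt hs ht hst (h.hasDerivWithinAt hs)
    rw [slope_def_field, div_le_iff₀ (by linarith)] at this
    linarith
  · simp
  · have := h.concave.le_slope_of_hasDerivWithinAt ht hs hst (h.hasDerivWithinAt hs)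
    rw [slope_def_field, le_div_iff₀ (by linarith)] at this
    linarith

/-- Strict concavity puts the chord strictly below `u` at the midpoint, where the weak tangent
inequality already applies. -/
theorem lt_tangent (h : Production u) (h' : StrictConcaveOn ℝ (Ici 0) u) (hs : 0 ≤ s)
    (ht : 0 ≤ t) (hst : s ≠ t) : u t < u s + marg u s * (t - s) := by
  have h1 := h'.2 (mem_Ici.2 hs) (mem_Ici.2 ht) hst (by norm_num : (0 : ℝ) < 1 / 2)
    (by norm_num : (0 : ℝ) < 1 / 2) (by norm_num)
  simp only [smul_eq_mul] at h1
  have h2 := h.le_tangent hs (t := 1 / 2 * s + 1 / 2 * t) (by positivity)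
  nlinarith

theorem marg_le_avg (h : Production u) (hs : 0 ≤ s) : marg u s ≤ avg u s := by
  unfold avg
  split_ifs with h0
  · rw [h0]
  · have hs' : 0 < s := lt_of_le_of_ne hs (Ne.symm h0)
    have := h.le_tangent hs (t := 0) le_rfl
    rw [h.zero] at this
    rw [le_div_iff₀ hs']
    linarith

theorem marg_lt_avg (h : Production u) (h' : StrictConcaveOn ℝ (Ici 0) u) (hs : 0 < s) :
    marg u s < avg u s := by
  have := h.lt_tangent h' hs.le (t := 0) le_rfl hs.ne'
  rw [h.zero] at this
  rw [avg, if_neg hs.ne', lt_div_iff₀ hs]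
  linarith

/-- The case `s = 0` is covered because the quotient is then `0` by convention; strict negativity
needs `0 < s`. -/
theorem avgSlope_nonpos (h : Production u) (hs : 0 ≤ s) : avgSlope u s ≤ 0 :=
  div_nonpos_of_nonpos_of_nonneg (sub_nonpos.2 (h.marg_le_avg hs)) hs

theorem avgSlope_neg (h : Production u) (h' : StrictConcaveOn ℝ (Ici 0) u) (hs : 0 < s) :
    avgSlope u s < 0 :=
  div_neg_of_neg_of_pos (sub_neg.2 (h.marg_lt_avg h' hs)) hs

theorem avg_mul_self (h : Production u) (s : ℝ) : avg u s * s = u s := by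
  unfold avg
  split_ifs with h0
  · simp [h0, h.zero]
  · field_simp

theorem avgSlope_mul_self (s : ℝ) : avgSlope u s * s = marg u s - avg u s := by
  unfold avgSlope avg
  split_ifs with h0
  · simp [h0]
  · field_simp

theorem avg_anti (h : Production u) (hs : 0 ≤ s) (hst : s ≤ t) : avg u t ≤ avg u s := by
  rcases hst.eq_or_lt with rfl | hst
  · exact le_rfl
  have ht : 0 < t := hs.trans_lt hst
  rcases hs.eq_or_lt with rfl | hs
  · rw [avg, avg, if_neg ht.ne', if_pos rfl, div_le_iff₀ ht]
    simpa [h.zero] using h.le_tangent le_rfl ht.le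
  · have h1 := h.concave.2 (mem_Ici.2 ht.le) (mem_Ici.2 (le_refl (0 : ℝ)))
      (by positivity : 0 ≤ s / t) (sub_nonneg.2 ((div_le_one ht).2 hst.le)) (by ring)
    have h2 : s / t * t = s := by field_simp
    simp only [smul_eq_mul, h.zero, mul_zero, add_zero, h2] at h1
    rw [avg, avg, if_neg ht.ne', if_neg hs.ne', le_div_iff₀ hs]
    calc u t / t * s = s / t * u t := by ring
      _ ≤ u s := h1

theorem continuousOn_avg (h : Production u) : ContinuousOn (avg u) (Ici 0) := by
  intro s hs
  rcases (mem_Ici.1 hs).eq_or_lt with rfl | hs'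
  · have h1 := hasDerivWithinAt_iff_tendsto_slope.1 (h.hasDerivWithinAt (le_refl (0 : ℝ)))
    have h2 : Tendsto (avg u) (𝓝[Ici 0 \ {0}] 0) (𝓝 (avg u 0)) := by
      rw [avg, if_pos rfl]
      refine h1.congr' ?_
      filter_upwards [self_mem_nhdsWithin] with t ht
      rw [slope_def_field, h.zero, sub_zero, sub_zero, avg, if_neg (fun h0 : t = 0 => ht.2 h0)]
    rw [← continuousWithinAt_sdiff_self]
    exact h2
  · have h1 : ContinuousWithinAt (fun t => u t / t) (Ici 0) s :=
      (h.hasDerivWithinAt hs).continuousWithinAt.div continuousWithinAt_id hs'.ne'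
    refine h1.congr_of_eventuallyEq ?_ (by simp [avg, hs'.ne'])
    filter_upwards [nhdsWithin_le_nhds (lt_mem_nhds hs')] with t ht
    simp [avg, ht.ne']

/-- Clamping the argument gives a continuous integrand on all of `ℝ`, as needed for a two-sided
fundamental theorem of calculus. -/
theorem continuous_avg_max (h : Production u) : Continuous fun t => avg u (max t 0) :=
  h.continuousOn_avg.comp_continuous (by fun_prop) fun t => le_max_right t 0

end Production

/-! ### The potential of a single market -/

/-- The contribution of one market to the potential. -/
def marketPotential (n : ℕ) (u : ℝ → ℝ) (s : ℝ) : ℝ :=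
  (1 - 1 / (n : ℝ)) * (∫ t in (0 : ℝ)..s, u t / t) + 1 / (n : ℝ) * u s

/-- The derivative of `marketPotential`. -/
def marketPrice (n : ℕ) (u : ℝ → ℝ) (s : ℝ) : ℝ :=
  (1 - 1 / (n : ℝ)) * avg u s + 1 / (n : ℝ) * marg u s

namespace Production

variable {u : ℝ → ℝ} {s t : ℝ}

theorem integral_avg (hs : 0 ≤ s) :
    ∫ t in (0 : ℝ)..s, u t / t = ∫ t in (0 : ℝ)..s, avg u (max t 0) := by
  refine intervalIntegral.integral_congr_ae (Eventually.of_forall fun t ht => ?_)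
  -- The half-open interval excludes `0`, the only point of `[0, s]` where `u t / t` (there `0`) and
  -- `avg u t` can differ.
  rw [uIoc_of_le hs] at ht
  rw [max_eq_left ht.1.le, avg, if_neg ht.1.ne']

theorem hasDerivWithinAt_integral (h : Production u) (hs : 0 ≤ s) :
    HasDerivWithinAt (fun s => ∫ t in (0 : ℝ)..s, u t / t) (avg u s) (Ici 0) s := by
  have h1 : HasDerivAt (fun s => ∫ t in (0 : ℝ)..s, avg u (max t 0)) (avg u (max s 0)) s :=
    intervalIntegral.integral_hasDerivAt_right
      (h.continuous_avg_max.intervalIntegrable _ _)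
      (h.continuous_avg_max.stronglyMeasurableAtFilter _ _)
      h.continuous_avg_max.continuousAt
  rw [max_eq_left hs] at h1
  exact h1.hasDerivWithinAt.congr (fun t ht => integral_avg ht) (integral_avg hs)

theorem hasDerivWithinAt_marketPotential (h : Production u) (n : ℕ) (hs : 0 ≤ s) :
    HasDerivWithinAt (marketPotential n u) (marketPrice n u s) (Ici 0) s :=
  ((h.hasDerivWithinAt_integral hs).const_mul _).add ((h.hasDerivWithinAt hs).const_mul _)

theorem contDiffOn_marketPotential (h : Production u) (n : ℕ) :
    ContDiffOn ℝ 1 (marketPotential n u) (Ici 0) := by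
  rw [contDiffOn_one_iff_derivWithin (uniqueDiffOn_Ici 0)]
  refine ⟨fun s hs => (h.hasDerivWithinAt_marketPotential n hs).differentiableWithinAt, ?_⟩
  have : ContinuousOn (marketPrice n u) (Ici 0) :=
    (continuousOn_const.mul h.continuousOn_avg).add (continuousOn_const.mul h.continuousOn_marg)
  exact this.congr fun s hs => (h.hasDerivWithinAt_marketPotential n hs).derivWithin
    (uniqueDiffOn_Ici 0 s hs)

theorem integral_le_tangent (h : Production u) (hs : 0 ≤ s) (ht : 0 ≤ t) :
    ∫ r in (0 : ℝ)..t, u r / r ≤ (∫ r in (0 : ℝ)..s, u r / r) + avg u s * (t - s) := by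
  have hi := fun a b => h.continuous_avg_max.intervalIntegrable (μ := volume) a b
  rw [integral_avg hs, integral_avg ht, ← sub_le_iff_le_add',
    intervalIntegral.integral_interval_sub_left (hi _ _) (hi _ _)]
  rcases le_total s t with hst | hst
  · have := intervalIntegral.integral_mono_on (μ := volume) hst (hi _ _)
      (intervalIntegrable_const (c := avg u s))
      fun r hr => by rw [max_eq_left (hs.trans hr.1)]; exact h.avg_anti hs hr.1
    simpa [mul_comm] using this
  · have := intervalIntegral.integral_mono_on (μ := volume) hst
      (intervalIntegrable_const (c := avg u s)) (hi _ _)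
      fun r hr => by rw [max_eq_left (ht.trans hr.1)]; exact h.avg_anti (ht.trans hr.1) hr.2
    rw [intervalIntegral.integral_symm]
    simp only [intervalIntegral.integral_const, smul_eq_mul] at this
    linarith

theorem marketPotential_le_tangent (h : Production u) {n : ℕ} (hn : 0 < n) (hs : 0 ≤ s)
    (ht : 0 ≤ t) :
    marketPotential n u t ≤ marketPotential n u s + marketPrice n u s * (t - s) := by
  have hn1 : (0 : ℝ) ≤ 1 - 1 / n := by
    rw [sub_nonneg, div_le_one (by exact_mod_cast hn)]; exact_mod_cast hn
  have h1 := mul_le_mul_of_nonneg_left (h.integral_le_tangent hs ht) hn1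
  have h2 := mul_le_mul_of_nonneg_left (h.le_tangent hs ht)
    (by positivity : (0 : ℝ) ≤ 1 / (n : ℝ))
  unfold marketPotential marketPrice
  linarith

theorem marketPotential_lt_tangent (h : Production u) (h' : StrictConcaveOn ℝ (Ici 0) u) {n : ℕ}
    (hn : 0 < n) (hs : 0 ≤ s) (ht : 0 ≤ t) (hst : s ≠ t) :
    marketPotential n u t < marketPotential n u s + marketPrice n u s * (t - s) := by
  have hn1 : (0 : ℝ) ≤ 1 - 1 / n := by
    rw [sub_nonneg, div_le_one (by exact_mod_cast hn)]; exact_mod_cast hn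
  have h1 := mul_le_mul_of_nonneg_left (h.integral_le_tangent hs ht) hn1
  have h2 := mul_lt_mul_of_pos_left (h.lt_tangent h' hs ht hst)
    (by positivity : (0 : ℝ) < 1 / (n : ℝ))
  unfold marketPotential marketPrice
  linarith

/-! ### Revenue of one firm in one market -/

/-- The revenue of a firm in one market as a function of its own allocation. -/
theorem hasDerivWithinAt_share (h : Production u) {q a : ℝ} (hq : 0 ≤ q) (ha : 0 ≤ a) :
    HasDerivWithinAt (fun t => u (q + t) / (q + t) * t)
      (avg u (q + a) + avgSlope u (q + a) * a) (Ici 0) a := by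
  rcases (add_nonneg hq ha).eq_or_lt with h0 | h0
  -- Without rivals the revenue is `u t` itself, and `avg u 0` was defined as its derivative at `0`.
  · obtain rfl : q = 0 := by linarith
    obtain rfl : a = 0 := by linarith
    have h1 := h.hasDerivWithinAt (le_refl (0 : ℝ))
    rw [add_zero, mul_zero, add_zero, avg, if_pos rfl]
    have h2 : ∀ t : ℝ, u (0 + t) / (0 + t) * t = u t := by
      intro t
      rcases eq_or_ne t 0 with rfl | ht
      · simp [h.zero]
      · rw [zero_add]; field_simp
    exact h1.congr (fun t _ => h2 t) (h2 0)
  · have h1 : HasDerivWithinAt (fun t => q + t) 1 (Ici 0) a := (hasDerivWithinAt_id a _).const_add q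
    have h2 : HasDerivWithinAt (fun t => u (q + t)) (marg u (q + a)) (Ici 0) a := by
      have h3 := (h.hasDerivWithinAt h0.le).comp a h1 fun t ht => add_nonneg hq ht
      rwa [mul_one] at h3
    refine ((h2.div h1 h0.ne').mul (hasDerivWithinAt_id a _)).congr_deriv ?_
    have h3 := h.avg_mul_self (q + a)
    simp only [Pi.div_apply, avgSlope, id, ← h3]
    field_simp
    ring

/-- Bound `u` by its tangent line at `q + a`, with intercept `-r (q + a)²` for the slope `r ≤ 0` of
the average. The proportional share of a line with nonnegative intercept is concave in the own
allocation. -/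
theorem share_le_tangent (h : Production u) {q a v : ℝ} (hq : 0 ≤ q) (ha : 0 ≤ a) (hv : 0 ≤ v) :
    u (q + v) / (q + v) * v ≤ u (q + a) / (q + a) * a +
      (avg u (q + a) + avgSlope u (q + a) * a) * (v - a) := by
  have h1 := h.le_tangent (add_nonneg hq ha) (add_nonneg hq hv)
  have h2 := h.avg_mul_self (q + a)
  have h3 := avgSlope_mul_self (u := u) (q + a)
  have h4 := h.avgSlope_nonpos (add_nonneg hq ha)
  have h5 : u (q + a) / (q + a) * a = avg u (q + a) * a := by
    rcases eq_or_ne (q + a) 0 with h0 | h0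
    · obtain rfl : a = 0 := by linarith
      simp
    · rw [avg, if_neg h0]
  rw [h5]
  generalize avg u (q + a) = p at *
  generalize avgSlope u (q + a) = r at *
  rcases (add_nonneg hq hv).eq_or_lt with h0 | h0
  · obtain rfl : q = 0 := by linarith
    obtain rfl : v = 0 := by linarith
    simp only [add_zero, mul_zero]
    nlinarith [mul_nonneg ha ha]
  · have hm : marg u (q + a) = p + r * (q + a) := by linarith
    rw [hm, ← h2] at h1
    have h6 : u (q + v) / (q + v) * v ≤
        (p * (q + a) + (p + r * (q + a)) * (q + v - (q + a))) / (q + v) * v := by gcongr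
    refine h6.trans ?_
    -- After clearing the denominator the two sides differ by exactly `-r q (v - a)²`.
    rw [div_mul_eq_mul_div, div_le_iff₀ h0]
    nlinarith [mul_nonneg hq (sq_nonneg (v - a))]

end Production

open scoped RealInnerProductSpace

variable {n m : ℕ}

theorem inner_eq_sum (v w : Strat m) : ⟪v, w⟫ = ∑ x, v x * w x := by
  simp [PiLp.inner_apply, mul_comm]

/-! ### Quadratic costs -/

/-- A presentation of a cost function as a quadratic polynomial with symmetric leading part. -/
structure QuadraticForm (c : Strat m → ℝ) where
  lin : Strat m →L[ℝ] Strat m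
  shift : Strat m
  const : ℝ
  symm : ∀ v w, ⟪lin v, w⟫ = ⟪lin w, v⟫
  eq : ∀ v, c v = 1 / 2 * ⟪lin v, v⟫ + ⟪shift, v⟫ + const

/-- Replacing `A` by its symmetric part does not change the polynomial, and symmetry makes `lin v +
shift` its gradient. -/
theorem Market.Smooth.nonempty_quadraticForm {g : Market m} (hs : g.Smooth) :
    Nonempty (QuadraticForm g.c) := by
  obtain ⟨A, b, k, h⟩ := hs.c_quadratic
  have happ : ∀ v : Strat m, ∀ x,
      (Matrix.toEuclideanCLM (𝕜 := ℝ) ((1 / 2 : ℝ) • (A + A.transpose)) v) x = ∑ y, 1 / 2 * (A x y + A y x) * v y := by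
    intro v x
    simp only [Matrix.ofLp_toEuclideanCLM, Matrix.mulVec, dotProduct, Matrix.smul_apply,
      Matrix.add_apply, Matrix.transpose_apply, smul_eq_mul]
  have hin : ∀ v w : Strat m,
      ⟪Matrix.toEuclideanCLM (𝕜 := ℝ) ((1 / 2 : ℝ) • (A + A.transpose)) v, w⟫
      = 1 / 2 * ∑ x, ∑ y, A x y * v y * w x + 1 / 2 * ∑ x, ∑ y, A x y * v x * w y := by
    intro v w
    rw [inner_eq_sum]
    conv_rhs => rw [Finset.sum_comm (f := fun x y => A x y * v x * w y)]
    rw [← mul_add, ← Finset.sum_add_distrib, Finset.mul_sum]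
    refine Finset.sum_congr rfl fun x _ => ?_
    rw [happ, ← Finset.sum_add_distrib, Finset.mul_sum, Finset.sum_mul]
    exact Finset.sum_congr rfl fun y _ => by ring
  refine ⟨⟨Matrix.toEuclideanCLM (𝕜 := ℝ) ((1 / 2 : ℝ) • (A + A.transpose)), WithLp.toLp 2 b, k,
    fun v w => ?_, fun v => ?_⟩⟩
  · rw [hin, hin, add_comm]
    congr 2 <;> exact Finset.sum_congr rfl fun x _ => Finset.sum_congr rfl fun y _ => by ring
  · rw [hin, h, inner_eq_sum]
    have : ∑ x, ∑ y, A x y * v y * v x = ∑ x, ∑ y, A x y * v x * v y :=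
      Finset.sum_congr rfl fun x _ => Finset.sum_congr rfl fun y _ => by ring
    rw [this]
    ring

namespace QuadraticForm

variable {c : Strat m → ℝ} (Q : QuadraticForm c)

/-- The gradient of the quadratic polynomial. -/
def grad (v : Strat m) : Strat m := Q.lin v + Q.shift

theorem expand (v w : Strat m) :
    c w = c v + ⟪Q.grad v, w - v⟫ + 1 / 2 * ⟪Q.lin (w - v), w - v⟫ := by
  have := Q.symm w v
  rw [Q.eq, Q.eq, grad]
  simp only [map_sub, inner_sub_left, inner_sub_right, inner_add_left]
  linarith

theorem continuous_grad : Continuous Q.grad := Q.lin.continuous.add continuous_const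

/-- The convexity gap at a midpoint is the quadratic form on the chord. Convexity is known only on
the simplex, so the form gets a sign only along differences of points there. -/
theorem midpoint (v w : Strat m) :
    c ((1 / 2 : ℝ) • v + (1 / 2 : ℝ) • w) =
      1 / 2 * c v + 1 / 2 * c w - 1 / 8 * ⟪Q.lin (w - v), w - v⟫ := by
  have := Q.symm w v
  rw [Q.eq, Q.eq, Q.eq]
  simp only [map_sub, map_add, map_smul, inner_sub_left, inner_sub_right, inner_add_left,
    inner_add_right, inner_smul_left, inner_smul_right]
  simp only [conj_trivial]
  linarith

theorem lin_nonneg {K : Set (Strat m)} (hc : ConvexOn ℝ K c) {v w : Strat m} (hv : v ∈ K)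
    (hw : w ∈ K) : 0 ≤ ⟪Q.lin (w - v), w - v⟫ := by
  have := hc.2 hv hw (by norm_num : (0 : ℝ) ≤ 1 / 2) (by norm_num : (0 : ℝ) ≤ 1 / 2) (by norm_num)
  rw [Q.midpoint] at this
  simp only [smul_eq_mul] at this
  linarith

theorem lin_pos {K : Set (Strat m)} (hc : StrictConvexOn ℝ K c) {v w : Strat m} (hv : v ∈ K)
    (hw : w ∈ K) (hvw : v ≠ w) : 0 < ⟪Q.lin (w - v), w - v⟫ := by
  have := hc.2 hv hw hvw (by norm_num : (0 : ℝ) < 1 / 2) (by norm_num : (0 : ℝ) < 1 / 2)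
    (by norm_num)
  rw [Q.midpoint] at this
  simp only [smul_eq_mul] at this
  linarith

end QuadraticForm

theorem Market.Standing.production {g : Market m} (hg : g.Standing) (hs : g.Smooth) (x : Fin m) :
    Production (g.u x) :=
  ⟨hg.u_zero x, hg.u_concave x, hs.u_contDiff x⟩

/-! ### Payoff gradients and first-order conditions -/

theorem agg_apply (S : Profile n m) (x : Fin m) : agg S x = ∑ i, S i x := by
  simp [agg]

theorem agg_update (S : Profile n m) (i : Fin n) (v : Strat m) :
    agg (Function.update S i v) = agg S - S i + v := by
  rw [agg, agg, Finset.sum_update_of_mem (Finset.mem_univ i),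
    ← Finset.add_sum_erase _ _ (Finset.mem_univ i), Finset.sdiff_singleton_eq_erase]
  abel

theorem le_agg {S : Profile n m} (hS : S ∈ profiles n m) (i : Fin n) (x : Fin m) :
    S i x ≤ agg S x := by
  rw [agg_apply]
  exact Finset.single_le_sum (f := fun i => S i x) (fun j _ => (hS j).1 x) (Finset.mem_univ i)

theorem agg_nonneg {S : Profile n m} (hS : S ∈ profiles n m) (x : Fin m) : 0 ≤ agg S x := by
  rw [agg_apply]
  exact Finset.sum_nonneg fun i _ => (hS i).1 x

theorem payoff_update (g : Market m) (S : Profile n m) (i : Fin n) (v : Strat m) :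
    payoff g i (Function.update S i v) =
      ∑ x, g.u x (agg S x - S i x + v x) / (agg S x - S i x + v x) * v x - g.c v := by
  simp [payoff, agg_update]

/-- The part of the payoff gradient that is due to revenue. -/
def revenueGrad (g : Market m) (i : Fin n) (S : Profile n m) : Strat m :=
  WithLp.toLp 2 fun x => avg (g.u x) (agg S x) + avgSlope (g.u x) (agg S x) * S i x

variable {g : Market m}

/-- Changing one coordinate leaves the simplex; the computation is possible because the cost is the
same polynomial on the whole space. -/
theorem gradPayoff_eq (hP : ∀ x, Production (g.u x)) (Q : QuadraticForm g.c) {S : Profile n m}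
    (hS : S ∈ profiles n m) (i : Fin n) :
    gradPayoff g i S = revenueGrad g i S - Q.grad (S i) := by
  ext x
  have hq : 0 ≤ agg S x - S i x := sub_nonneg.2 (le_agg hS i x)
  have h1 := (hP x).hasDerivWithinAt_share hq ((hS i).1 x)
  have hupd : ∀ t : ℝ, (WithLp.toLp 2 (Function.update (S i).ofLp x t) : Strat m) - S i
      = (t - S i x) • EuclideanSpace.single x 1 := by
    intro t
    ext y
    rcases eq_or_ne y x with rfl | hy
    · simp
    · simp [hy]
  have hfun : ∀ t : ℝ, payoff g i
      (Function.update S i (WithLp.toLp 2 (Function.update (S i).ofLp x t))) =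
      g.u x (agg S x - S i x + t) / (agg S x - S i x + t) * t
      + ∑ y ∈ Finset.univ.erase x, g.u y (agg S y) / agg S y * S i y
      - (g.c (S i) + (t - S i x) * Q.grad (S i) x + (t - S i x) ^ 2 *
        (1 / 2 * ⟪Q.lin (EuclideanSpace.single x 1), EuclideanSpace.single x 1⟫)) := by
    intro t
    rw [payoff_update, Q.expand (S i), hupd, ← Finset.add_sum_erase _ _ (Finset.mem_univ x)]
    congr 1
    · congr 1
      · simp
      · refine Finset.sum_congr rfl fun y hy => ?_
        simp [(Finset.mem_erase.1 hy).1]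
    · rw [map_smul, inner_smul_right, inner_smul_left, inner_smul_right]
      simp only [conj_trivial]
      rw [inner_eq_sum (Q.grad (S i))]
      simp
      ring
  have h2 : HasDerivAt (fun t : ℝ => g.c (S i) + (t - S i x) * Q.grad (S i) x + (t - S i x) ^ 2 *
        (1 / 2 * ⟪Q.lin (EuclideanSpace.single x 1), EuclideanSpace.single x 1⟫))
        (Q.grad (S i) x) (S i x) := by
    have h3 : HasDerivAt (fun t : ℝ => t - S i x) 1 (S i x) := (hasDerivAt_id _).sub_const _
    refine (((h3.mul_const (Q.grad (S i) x)).const_add (g.c (S i))).add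
      ((h3.pow 2).mul_const _)).congr_deriv ?_
    simp
  have h4 := ((h1.add_const (∑ y ∈ Finset.univ.erase x, g.u y (agg S y) / agg S y * S i y)).sub
    h2.hasDerivWithinAt)
  have h5 := (h4.congr (fun t _ => hfun t) (hfun _)).derivWithin
    (uniqueDiffOn_Ici 0 _ ((hS i).1 x))
  simp only [gradPayoff]
  rw [h5]
  simp [revenueGrad]

/-- Concavity of the payoff in the own strategy, market by market. It makes the first-order
condition sufficient for a best reply. -/
theorem payoff_le_tangent (hP : ∀ x, Production (g.u x)) (Q : QuadraticForm g.c)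
    (hc : ConvexOn ℝ (simplex m) g.c) {S : Profile n m} (hS : S ∈ profiles n m) (i : Fin n)
    {v : Strat m} (hv : v ∈ simplex m) :
    payoff g i (Function.update S i v) ≤ payoff g i S + ⟪gradPayoff g i S, v - S i⟫ := by
  have h1 : payoff g i S = payoff g i (Function.update S i (S i)) := by
    rw [Function.update_eq_self]
  have h2 := Q.lin_nonneg hc (hS i) hv
  rw [h1, payoff_update, payoff_update, gradPayoff_eq hP Q hS, inner_sub_left, Q.expand (S i) v,
    inner_eq_sum (revenueGrad g i S)]
  have h3 : ∑ x, g.u x (agg S x - S i x + v x) / (agg S x - S i x + v x) * v x ≤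
      ∑ x, g.u x (agg S x - S i x + S i x) / (agg S x - S i x + S i x) * S i x +
        ∑ x, revenueGrad g i S x * (v - S i) x := by
    rw [← Finset.sum_add_distrib]
    refine Finset.sum_le_sum fun x _ => ?_
    have := (hP x).share_le_tangent (sub_nonneg.2 (le_agg hS i x)) ((hS i).1 x) (hv.1 x)
    simpa only [sub_add_cancel, revenueGrad, PiLp.sub_apply] using this
  linarith

theorem deriv_nonpos_of_max {f : ℝ → ℝ} {f' : ℝ} (hf : HasDerivWithinAt f f' (Icc 0 1) 0)
    (hmax : ∀ t ∈ Icc (0 : ℝ) 1, f t ≤ f 0) : f' ≤ 0 := by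
  have h1 := (hasDerivWithinAt_iff_tendsto_slope.1 hf)
  rw [Icc_sdiff_left] at h1
  have : (𝓝[Ioc (0 : ℝ) 1] 0).NeBot := by
    rw [nhdsWithin_Ioc_eq_nhdsGT one_pos]; infer_instance
  refine le_of_tendsto h1 ?_
  filter_upwards [self_mem_nhdsWithin] with t ht
  rw [slope_def_field]
  exact div_nonpos_of_nonpos_of_nonneg (sub_nonpos.2 (hmax t ⟨ht.1.le, ht.2⟩)) (by linarith [ht.1])

theorem simplex_segment {a v : Strat m} (ha : a ∈ simplex m) (hv : v ∈ simplex m) {t : ℝ}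
    (ht : t ∈ Icc (0 : ℝ) 1) : a + t • (v - a) ∈ simplex m := by
  refine ⟨fun x => ?_, ?_⟩
  · have := mul_nonneg ht.1 (hv.1 x)
    have := mul_nonneg (sub_nonneg.2 ht.2) (ha.1 x)
    simp only [PiLp.add_apply, PiLp.smul_apply, PiLp.sub_apply, smul_eq_mul]
    linarith
  · simp [Finset.sum_add_distrib, ← Finset.mul_sum, ha.2, hv.2]

theorem hasDerivWithinAt_segment (a v : Strat m) (x : Fin m) (s : Set ℝ) (t : ℝ) :
    HasDerivWithinAt (fun t : ℝ => (a + t • (v - a)) x) ((v - a) x) s t := by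
  have h := ((hasDerivAt_id t).mul_const ((v - a) x)).const_add (a x)
  rw [one_mul] at h
  exact h.hasDerivWithinAt

theorem QuadraticForm.hasDerivAt_segment {c : Strat m → ℝ} (Q : QuadraticForm c) (a d : Strat m) :
    HasDerivAt (fun t : ℝ => c (a + t • d)) ⟪Q.grad a, d⟫ 0 := by
  have h1 : (fun t : ℝ => c (a + t • d)) =
      fun t => c a + t * ⟪Q.grad a, d⟫ + t ^ 2 * (1 / 2 * ⟪Q.lin d, d⟫) := by
    funext t
    rw [Q.expand a, add_sub_cancel_left, map_smul, inner_smul_right, inner_smul_left,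
      inner_smul_right]
    simp only [conj_trivial]
    ring
  rw [h1]
  refine ((((hasDerivAt_id (0 : ℝ)).mul_const ⟪Q.grad a, d⟫).const_add (c a)).add
    (((hasDerivAt_id (0 : ℝ)).pow 2).mul_const _)).congr_deriv ?_
  simp

theorem IsNash.inner_nonpos (hP : ∀ x, Production (g.u x)) (Q : QuadraticForm g.c)
    {S : Profile n m} (hS : IsNash g S) (i : Fin n) {v : Strat m} (hv : v ∈ simplex m) :
    ⟪gradPayoff g i S, v - S i⟫ ≤ 0 := by
  have hseg := fun t ht => simplex_segment (hS.1 i) hv (t := t) ht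
  refine deriv_nonpos_of_max
    (f := fun t : ℝ => payoff g i (Function.update S i (S i + t • (v - S i)))) ?_ ?_
  · simp only [payoff_update]
    rw [gradPayoff_eq hP Q hS.1, inner_sub_left]
    refine HasDerivWithinAt.sub ?_ (Q.hasDerivAt_segment _ _).hasDerivWithinAt
    rw [inner_eq_sum]
    refine HasDerivWithinAt.fun_sum fun x _ => ?_
    have h1 := hasDerivWithinAt_segment (S i) v x (Icc 0 1) 0
    have h2 := (hP x).hasDerivWithinAt_share (sub_nonneg.2 (le_agg hS.1 i x)) ((hS.1 i).1 x)
    have h3 : (S i + (0 : ℝ) • (v - S i)) x = S i x := by simp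
    rw [sub_add_cancel] at h2
    exact HasDerivWithinAt.comp_of_eq (0 : ℝ) h2 h1 (fun t ht => (hseg t ht).1 x) h3.symm
  · intro t ht
    have := hS.2 i _ (hseg t ht)
    simpa using this

theorem continuous_agg_apply (x : Fin m) : Continuous fun S : Profile n m => agg S x := by
  simp only [agg_apply]
  fun_prop

/-- The only delicate points have `s_x = 0`, where `avgSlope` may blow up. Since `0 ≤ s_ix ≤ s_x`,
the product `avgSlope * s_ix` is bounded by `|marg - avg|`, which tends to `0` there. -/
theorem continuousOn_revenueGrad (hP : ∀ x, Production (g.u x)) (i : Fin n) :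
    ContinuousOn (revenueGrad g i) (profiles n m) := by
  refine (PiLp.continuous_toLp 2 _).comp_continuousOn (continuousOn_pi.2 fun x => ?_)
  have hagg : ContinuousOn (fun S : Profile n m => agg S x) (profiles n m) :=
    (continuous_agg_apply x).continuousOn
  have hmaps : MapsTo (fun S : Profile n m => agg S x) (profiles n m) (Ici 0) :=
    fun S hS => agg_nonneg hS x
  have havg := (hP x).continuousOn_avg.comp hagg hmaps
  have hmarg := (hP x).continuousOn_marg.comp hagg hmaps
  have hcoord : Continuous fun S : Profile n m => S i x := by fun_prop
  refine havg.add fun S hS => ?_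
  rcases (agg_nonneg hS x).eq_or_lt with h0 | h0
  · have hSi : S i x = 0 := le_antisymm (h0 ▸ le_agg hS i x) ((hS i).1 x)
    have hlim : Tendsto (fun S : Profile n m => marg (g.u x) (agg S x) - avg (g.u x) (agg S x))
        (𝓝[profiles n m] S) (𝓝 0) := by
      have := (hmarg.sub havg) S hS
      unfold ContinuousWithinAt at this
      simpa [← h0, avg] using! this
    unfold ContinuousWithinAt
    simp only [hSi, mul_zero]
    refine squeeze_zero_norm' ?_ (by simpa using hlim.abs)
    filter_upwards [self_mem_nhdsWithin] with T hT
    rw [← Production.avgSlope_mul_self, Real.norm_eq_abs, abs_mul, abs_mul,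
      abs_of_nonneg ((hT i).1 x), abs_of_nonneg (agg_nonneg hT x)]
    exact mul_le_mul_of_nonneg_left (le_agg hT i x) (abs_nonneg _)
  · exact (((hmarg S hS).sub (havg S hS)).div (hagg S hS) h0.ne').mul
      hcoord.continuousWithinAt

theorem continuousOn_gradPayoff (hP : ∀ x, Production (g.u x)) (Q : QuadraticForm g.c)
    (i : Fin n) : ContinuousOn (gradPayoff g i) (profiles n m) :=
  ((continuousOn_revenueGrad hP i).sub
    (Q.continuous_grad.comp (continuous_apply i)).continuousOn).congr
    fun _ hS => gradPayoff_eq hP Q hS i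

/-! ### Geometry of strategies, profiles and aggregates -/

theorem convex_simplex : Convex ℝ (simplex m) := by
  intro a ha b hb p q hp hq hpq
  refine ⟨fun x => ?_, ?_⟩
  · exact add_nonneg (mul_nonneg hp (ha.1 x)) (mul_nonneg hq (hb.1 x))
  · simp [Finset.sum_add_distrib, ← Finset.mul_sum, ha.2, hb.2, hpq]

theorem isCompact_simplex : IsCompact (simplex m) := by
  refine Metric.isCompact_of_isClosed_isBounded ?_ ?_
  · have h : simplex m = (⋂ x, {v : Strat m | 0 ≤ v x}) ∩ {v | ∑ x, v x = 1} := by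
      ext v
      simp [simplex]
    rw [h]
    exact (isClosed_iInter fun x => isClosed_le continuous_const (by fun_prop)).inter
      (isClosed_eq (by fun_prop) continuous_const)
  · refine (Metric.isBounded_closedBall (x := (0 : Strat m)) (r := 1)).subset fun v hv => ?_
    rw [mem_closedBall_zero_iff, ← sq_le_one_iff₀ (norm_nonneg v), EuclideanSpace.real_norm_sq_eq,
      ← hv.2]
    refine Finset.sum_le_sum fun x _ => ?_
    have h1 : v x ≤ 1 := by
      rw [← hv.2]
      exact Finset.single_le_sum (f := fun x => v x) (fun y _ => hv.1 y) (Finset.mem_univ x)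
    nlinarith [hv.1 x]

theorem simplex_nonempty (hm : 0 < m) : (simplex m).Nonempty := by
  refine ⟨EuclideanSpace.single ⟨0, hm⟩ 1, fun x => ?_, by simp⟩
  rw [PiLp.single_apply]
  split_ifs <;> norm_num

theorem isCompact_profiles : IsCompact (profiles n m) := by
  have h : profiles n m = Set.univ.pi fun _ => simplex m := by
    ext S
    simp [profiles]
  rw [h]
  exact isCompact_univ_pi fun _ => isCompact_simplex

/-- The aggregate strategies of `n` firms: the points of the simplex, scaled by `n`. -/
def aggregates (n m : ℕ) : Set (Strat m) := {s | (n : ℝ)⁻¹ • s ∈ simplex m}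

theorem smul_mem_aggregates (hn : 0 < n) {v : Strat m} (hv : v ∈ simplex m) :
    (n : ℝ) • v ∈ aggregates n m := by
  have : (n : ℝ) ≠ 0 := by positivity
  simpa [aggregates, this] using hv

theorem aggregates_eq_image (hn : 0 < n) :
    aggregates n m = (fun v : Strat m => (n : ℝ) • v) '' simplex m := by
  have hn' : (n : ℝ) ≠ 0 := by positivity
  ext s
  constructor
  · intro hs
    exact ⟨_, hs, by simp [hn']⟩
  · rintro ⟨v, hv, rfl⟩
    exact smul_mem_aggregates hn hv

theorem isCompact_aggregates (hn : 0 < n) : IsCompact (aggregates n m) := by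
  rw [aggregates_eq_image hn]
  exact isCompact_simplex.image (by fun_prop)

theorem agg_mem_aggregates (hn : 0 < n) {S : Profile n m} (hS : S ∈ profiles n m) :
    agg S ∈ aggregates n m := by
  have hn' : (n : ℝ) ≠ 0 := by positivity
  refine ⟨fun x => ?_, ?_⟩
  · exact mul_nonneg (by positivity) (agg_nonneg hS x)
  · simp only [PiLp.smul_apply, smul_eq_mul, ← Finset.mul_sum, agg_apply]
    rw [Finset.sum_comm, Finset.sum_congr rfl fun i _ => (hS i).2]
    simp [hn']

theorem nonneg_of_mem_aggregates (hn : 0 < n) {s : Strat m} (hs : s ∈ aggregates n m)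
    (x : Fin m) : 0 ≤ s x := by
  have h : 0 ≤ (n : ℝ)⁻¹ * s x := hs.1 x
  exact nonneg_of_mul_nonneg_right h (by positivity)

theorem sum_of_mem_aggregates (hn : 0 < n) {s : Strat m} (hs : s ∈ aggregates n m) :
    ∑ x, s x = n := by
  have hn' : (n : ℝ) ≠ 0 := by positivity
  have h := hs.2
  simp only [PiLp.smul_apply, smul_eq_mul, ← Finset.mul_sum] at h
  field_simp at h
  exact h

/-- This is why one market `y` may be exempt from strict concavity. -/
theorem exists_ne_of_sum_eq_zero {d : Strat m} (h : ∑ x, d x = 0) (hd : d ≠ 0) (y : Fin m) :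
    ∃ x, x ≠ y ∧ d x ≠ 0 := by
  by_contra! hcon
  refine hd (PiLp.ext fun x => ?_)
  rcases eq_or_ne x y with rfl | hx
  · rwa [Finset.sum_eq_single x (fun z _ hz => hcon z hz) (by simp)] at h
  · exact hcon x hx

/-! ### Strict concavity and derivative of the potential -/

/-- The gradient of the potential at the aggregate strategy `s`. -/
def potentialGrad {g : Market m} (Q : QuadraticForm g.c) (n : ℕ) (s : Strat m) : Strat m :=
  WithLp.toLp 2 (fun x => marketPrice n (g.u x) (s x)) - Q.grad ((n : ℝ)⁻¹ • s)

variable {g : Market m}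

theorem potential_eq (g : Market m) (n : ℕ) (s : Strat m) :
    potential g n s = ∑ x, marketPotential n (g.u x) (s x) - n * g.c ((n : ℝ)⁻¹ • s) := rfl

theorem cost_tangent (Q : QuadraticForm g.c) (hn : 0 < n) (s t : Strat m) :
    n * g.c ((n : ℝ)⁻¹ • t) = n * g.c ((n : ℝ)⁻¹ • s) + ⟪Q.grad ((n : ℝ)⁻¹ • s), t - s⟫
      + n * (1 / 2 * ⟪Q.lin ((n : ℝ)⁻¹ • t - (n : ℝ)⁻¹ • s), (n : ℝ)⁻¹ • t - (n : ℝ)⁻¹ • s⟫) := by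
  have hn' : (n : ℝ) ≠ 0 := by positivity
  rw [Q.expand ((n : ℝ)⁻¹ • s), mul_add, mul_add]
  congr 2
  rw [← smul_sub, inner_smul_right, mul_inv_cancel_left₀ hn']

theorem potential_lt_tangent (hg : g.Standing) (hP : ∀ x, Production (g.u x))
    (Q : QuadraticForm g.c) (hn : 0 < n) {s t : Strat m} (hs : s ∈ aggregates n m)
    (ht : t ∈ aggregates n m) (hst : s ≠ t) :
    potential g n t < potential g n s + ⟪potentialGrad Q n s, t - s⟫ := by
  have hn' : (n : ℝ) ≠ 0 := by positivity
  have h2 := cost_tangent Q hn s t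
  have h3 : (0 : ℝ) < n := by positivity
  have h5 : ∀ x, marketPotential n (g.u x) (t x) ≤ marketPotential n (g.u x) (s x)
      + marketPrice n (g.u x) (s x) * (t - s) x := fun x =>
    (hP x).marketPotential_le_tangent hn
      (nonneg_of_mem_aggregates hn hs x) (nonneg_of_mem_aggregates hn ht x)
  rw [potential_eq, potential_eq, potentialGrad, inner_sub_left, inner_eq_sum (WithLp.toLp 2 _)]
  rcases hg.strict with ⟨y, hy⟩ | hc
  · have h4 := mul_nonneg h3.le (Q.lin_nonneg hg.c_convex hs ht)
    obtain ⟨x, hxy, hx⟩ := exists_ne_of_sum_eq_zero (d := t - s)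
      (by simp [sum_of_mem_aggregates hn hs, sum_of_mem_aggregates hn ht])
      (sub_ne_zero.2 hst.symm) y
    have h6 : ∑ x, marketPotential n (g.u x) (t x) < ∑ x, marketPotential n (g.u x) (s x)
        + ∑ x, marketPrice n (g.u x) (s x) * (t - s) x := by
      rw [← Finset.sum_add_distrib]
      refine Finset.sum_lt_sum (fun x _ => h5 x) ⟨x, Finset.mem_univ x, ?_⟩
      exact (hP x).marketPotential_lt_tangent (hy x hxy) hn
        (nonneg_of_mem_aggregates hn hs x) (nonneg_of_mem_aggregates hn ht x)
        fun h => hx (by simp [h])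
    linarith
  · have h1 := Q.lin_pos hc hs ht fun h => hst (by
      simpa using (smul_right_injective (Strat m) (inv_ne_zero hn')) h)
    have h4 := mul_pos h3 h1
    have h6 : ∑ x, marketPotential n (g.u x) (t x) ≤ ∑ x, marketPotential n (g.u x) (s x)
        + ∑ x, marketPrice n (g.u x) (s x) * (t - s) x := by
      rw [← Finset.sum_add_distrib]
      exact Finset.sum_le_sum fun x _ => h5 x
    linarith

theorem continuousOn_potential (hP : ∀ x, Production (g.u x)) (Q : QuadraticForm g.c)
    (hn : 0 < n) : ContinuousOn (potential g n) (aggregates n m) := by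
  refine ContinuousOn.sub (continuousOn_finsetSum _ fun x _ => ?_) (Continuous.continuousOn ?_)
  · have hcoord : Continuous fun s : Strat m => s x := by fun_prop
    exact ((hP x).contDiffOn_marketPotential n).continuousOn.comp hcoord.continuousOn
      fun s hs => nonneg_of_mem_aggregates hn hs x
  · have h : g.c = fun v => 1 / 2 * ⟪Q.lin v, v⟫ + ⟪Q.shift, v⟫ + Q.const := funext Q.eq
    rw [h]
    fun_prop

theorem hasDerivWithinAt_potential (hP : ∀ x, Production (g.u x)) (Q : QuadraticForm g.c)
    (hn : 0 < n) {a d : Strat m} {A : Set ℝ} (ha : ∀ x, 0 ≤ a x)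
    (hA : ∀ τ ∈ A, ∀ x, 0 ≤ (a + τ • d) x) :
    HasDerivWithinAt (fun τ : ℝ => potential g n (a + τ • d)) ⟪potentialGrad Q n a, d⟫ A 0 := by
  have hn' : (n : ℝ) ≠ 0 := by positivity
  simp only [potential_eq]
  rw [potentialGrad, inner_sub_left, inner_eq_sum (WithLp.toLp 2 _)]
  refine HasDerivWithinAt.sub ?_ ?_
  · refine HasDerivWithinAt.fun_sum fun x _ => ?_
    have h1 := hasDerivWithinAt_segment a (a + d) x A 0
    simp only [add_sub_cancel_left] at h1
    exact HasDerivWithinAt.comp_of_eq (0 : ℝ) ((hP x).hasDerivWithinAt_marketPotential n (ha x))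
      h1 (fun τ hτ => hA τ hτ x) (by simp)
  · have h1 := (Q.hasDerivAt_segment ((n : ℝ)⁻¹ • a) ((n : ℝ)⁻¹ • d)).const_mul (n : ℝ)
    rw [inner_smul_right, mul_inv_cancel_left₀ hn'] at h1
    have h2 : ∀ τ : ℝ, (n : ℝ)⁻¹ • (a + τ • d) = (n : ℝ)⁻¹ • a + τ • (n : ℝ)⁻¹ • d := fun τ => by
      rw [smul_add, smul_comm]
    simp only [h2]
    exact h1.hasDerivWithinAt

/-! ### Decomposition of the payoff gradients -/

/-- The linear dependence of the payoff gradient on the deviation from the average strategy. -/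
def response (Q : QuadraticForm g.c) (s : Strat m) : Strat m →ₗ[ℝ] Strat m where
  toFun d := WithLp.toLp 2 (fun x => avgSlope (g.u x) (s x) * d x) - Q.lin d
  map_add' d e := by
    ext x
    simp only [map_add, PiLp.sub_apply, PiLp.add_apply]
    ring
  map_smul' r d := by
    ext x
    simp only [map_smul, PiLp.sub_apply, PiLp.smul_apply, smul_eq_mul, RingHom.id_apply]
    ring

/-- At the average allocation `s_x / n` the term `avgSlope * s_x / n` equals `(marg - avg) / n`,
which turns `avg` into `marketPrice`; this dictates the weights `1 - 1/n` and `1/n` in the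
potential. What remains is linear in the deviation, since the gradient of a quadratic cost is
affine. -/
theorem gradPayoff_eq_response (hP : ∀ x, Production (g.u x)) (Q : QuadraticForm g.c)
    {S : Profile n m} (hS : S ∈ profiles n m) (i : Fin n) :
    gradPayoff g i S =
      potentialGrad Q n (agg S) + response Q (agg S) (S i - symm S i) := by
  rw [gradPayoff_eq hP Q hS]
  ext x
  have h1 := Production.avgSlope_mul_self (u := g.u x) (agg S x)
  simp only [revenueGrad, potentialGrad, response, symm, QuadraticForm.grad, LinearMap.coe_mk,
    AddHom.coe_mk, map_sub, PiLp.sub_apply, PiLp.add_apply, PiLp.smul_apply, smul_eq_mul,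
    marketPrice]
  linear_combination ((n : ℝ)⁻¹) * h1

theorem sum_deviation (hn : 0 < n) (S : Profile n m) : ∑ i, (S i - symm S i) = 0 := by
  have hn' : (n : ℝ) ≠ 0 := by positivity
  simp only [symm, Finset.sum_sub_distrib, Finset.sum_const, Finset.card_univ, Fintype.card_fin]
  rw [← Nat.cast_smul_eq_nsmul ℝ, smul_inv_smul₀ hn', agg, sub_self]

theorem inner_response (Q : QuadraticForm g.c) (s d : Strat m) :
    ⟪response Q s d, d⟫ = ∑ x, avgSlope (g.u x) (s x) * d x ^ 2 - ⟪Q.lin d, d⟫ := by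
  simp only [response, LinearMap.coe_mk, AddHom.coe_mk, inner_sub_left]
  rw [inner_eq_sum (WithLp.toLp 2 _)]
  congr 1
  exact Finset.sum_congr rfl fun x _ => by simp only; ring

theorem response_nonpos (hP : ∀ x, Production (g.u x)) (Q : QuadraticForm g.c)
    (hc : ConvexOn ℝ (simplex m) g.c) (hn : 0 < n) {S : Profile n m} (hS : S ∈ profiles n m)
    (i : Fin n) : ⟪response Q (agg S) (S i - symm S i), S i - symm S i⟫ ≤ 0 := by
  have hsymm : symm S i ∈ simplex m := agg_mem_aggregates hn hS
  have h1 := Q.lin_nonneg hc hsymm (hS i)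
  have h2 : ∑ x, avgSlope (g.u x) (agg S x) * (S i - symm S i) x ^ 2 ≤ 0 :=
    Finset.sum_nonpos fun x _ => mul_nonpos_of_nonpos_of_nonneg
      ((hP x).avgSlope_nonpos (agg_nonneg hS x)) (sq_nonneg _)
  rw [inner_response]
  linarith

theorem response_neg (hg : g.Standing) (hP : ∀ x, Production (g.u x)) (Q : QuadraticForm g.c)
    (hn : 0 < n) {S : Profile n m} (hS : S ∈ profiles n m) {i : Fin n} (hi : S i ≠ symm S i) :
    ⟪response Q (agg S) (S i - symm S i), S i - symm S i⟫ < 0 := by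
  have hsymm : symm S i ∈ simplex m := agg_mem_aggregates hn hS
  have h1 : ∀ x, avgSlope (g.u x) (agg S x) * (S i - symm S i) x ^ 2 ≤ 0 :=
    fun x => mul_nonpos_of_nonpos_of_nonneg
      ((hP x).avgSlope_nonpos (agg_nonneg hS x)) (sq_nonneg _)
  rw [inner_response]
  rcases hg.strict with ⟨y, hy⟩ | hc
  · have h2 := Q.lin_nonneg hg.c_convex hsymm (hS i)
    obtain ⟨x, hxy, hx⟩ := exists_ne_of_sum_eq_zero (d := S i - symm S i)
      (by simp [(hS i).2, hsymm.2]) (sub_ne_zero.2 hi) y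
    -- An empty market allows no deviation: both `S i x` and the average vanish there.
    have h3 : 0 < agg S x := by
      refine lt_of_le_of_ne (agg_nonneg hS x) fun h0 => hx ?_
      have h4 : S i x = 0 := le_antisymm (h0 ▸ le_agg hS i x) ((hS i).1 x)
      simp [symm, h4, ← h0]
    have h5 := Finset.sum_lt_sum (fun x _ => h1 x) ⟨x, Finset.mem_univ x,
      mul_neg_of_neg_of_pos ((hP x).avgSlope_neg (hy x hxy) h3) (by positivity)⟩
    simp only [Finset.sum_const_zero] at h5
    linarith
  · have h2 := Q.lin_pos hc hsymm (hS i) hi.symm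
    have h3 := Finset.sum_nonpos fun x (_ : x ∈ Finset.univ) => h1 x
    linarith

/-- The pairing of the payoff gradients with the displacement from the profile in which every firm
plays `a`. -/
def drift (g : Market m) (a : Strat m) (S : Profile n m) : ℝ :=
  ∑ i, ⟪gradPayoff g i S, S i - a⟫

/-- Splitting `s_i - s/n` through the average of `S` leaves a cross term in which `response` is
applied to the sum of the deviations, which is zero. -/
theorem drift_eq (hP : ∀ x, Production (g.u x)) (Q : QuadraticForm g.c) (hn : 0 < n)
    (s : Strat m) {S : Profile n m} (hS : S ∈ profiles n m) :
    drift g ((n : ℝ)⁻¹ • s) S = ⟪potentialGrad Q n (agg S), agg S - s⟫ +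
      ∑ i, ⟪response Q (agg S) (S i - symm S i), S i - symm S i⟫ := by
  have hn' : (n : ℝ) ≠ 0 := by positivity
  have h1 : ∑ i : Fin n, ((n : ℝ)⁻¹ • s) = s := by
    rw [Finset.sum_const, Finset.card_univ, Fintype.card_fin, ← Nat.cast_smul_eq_nsmul ℝ,
      smul_inv_smul₀ hn']
  have h2 : ∀ i, ⟪gradPayoff g i S, S i - (n : ℝ)⁻¹ • s⟫ =
      ⟪potentialGrad Q n (agg S), S i - (n : ℝ)⁻¹ • s⟫
      + ⟪response Q (agg S) (S i - symm S i), S i - symm S i⟫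
      + ⟪response Q (agg S) (S i - symm S i), (n : ℝ)⁻¹ • agg S - (n : ℝ)⁻¹ • s⟫ := by
    intro i
    rw [gradPayoff_eq_response hP Q hS, inner_add_left, add_assoc, ← inner_add_right]
    congr 2
    simp [symm]
  rw [drift, Finset.sum_congr rfl fun i _ => h2 i, Finset.sum_add_distrib, Finset.sum_add_distrib,
    ← inner_sum, ← sum_inner, ← map_sum, sum_deviation hn, map_zero, inner_zero_left, add_zero,
    Finset.sum_sub_distrib, h1]
  rfl

/-! ### The maximizer of the potential and the unique equilibrium -/

theorem exists_isMaxOn_potential (hP : ∀ x, Production (g.u x)) (Q : QuadraticForm g.c)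
    (hn : 0 < n) (hm : 0 < m) : ∃ s ∈ aggregates n m, IsMaxOn (potential g n) (aggregates n m) s :=
  (isCompact_aggregates hn).exists_isMaxOn
    (aggregates_eq_image (m := m) hn ▸ (simplex_nonempty hm).image _)
    (continuousOn_potential hP Q hn)

theorem convex_aggregates (hn : 0 < n) : Convex ℝ (aggregates n m) := by
  rw [aggregates_eq_image hn]
  exact convex_simplex.smul _

theorem inner_potentialGrad_nonpos (hP : ∀ x, Production (g.u x)) (Q : QuadraticForm g.c)
    (hn : 0 < n) {s t : Strat m} (hs : s ∈ aggregates n m)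
    (hmax : IsMaxOn (potential g n) (aggregates n m) s) (ht : t ∈ aggregates n m) :
    ⟪potentialGrad Q n s, t - s⟫ ≤ 0 := by
  have hseg : ∀ τ ∈ Icc (0 : ℝ) 1, s + τ • (t - s) ∈ aggregates n m := fun τ hτ =>
    (convex_aggregates hn).add_smul_sub_mem hs ht hτ
  refine deriv_nonpos_of_max (hasDerivWithinAt_potential hP Q hn (nonneg_of_mem_aggregates hn hs)
    fun τ hτ => nonneg_of_mem_aggregates hn (hseg τ hτ)) fun τ hτ => ?_
  simpa using hmax (hseg τ hτ)

theorem potential_lt_max (hg : g.Standing) (hP : ∀ x, Production (g.u x))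
    (Q : QuadraticForm g.c) (hn : 0 < n) {s t : Strat m} (hs : s ∈ aggregates n m)
    (hmax : IsMaxOn (potential g n) (aggregates n m) s) (ht : t ∈ aggregates n m) (hts : t ≠ s) :
    potential g n t < potential g n s := by
  linarith [potential_lt_tangent hg hP Q hn hs ht hts.symm,
    inner_potentialGrad_nonpos hP Q hn hs hmax ht]

theorem inner_potentialGrad_neg (hg : g.Standing) (hP : ∀ x, Production (g.u x))
    (Q : QuadraticForm g.c) (hn : 0 < n) {s t : Strat m} (hs : s ∈ aggregates n m)
    (hmax : IsMaxOn (potential g n) (aggregates n m) s) (ht : t ∈ aggregates n m) (hts : t ≠ s) :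
    ⟪potentialGrad Q n t, t - s⟫ < 0 := by
  have h1 := potential_lt_tangent hg hP Q hn ht hs hts
  rw [← neg_sub t s, inner_neg_right] at h1
  linarith [potential_lt_max hg hP Q hn hs hmax ht hts]

/-- The profile in which every firm plays an `n`-th of `s`. -/
def uniformProfile (n : ℕ) (s : Strat m) : Profile n m := fun _ => (n : ℝ)⁻¹ • s

theorem agg_uniformProfile (hn : 0 < n) (s : Strat m) : agg (uniformProfile n s) = s := by
  have hn' : (n : ℝ) ≠ 0 := by positivity
  simp only [agg, uniformProfile]
  rw [Finset.sum_const, Finset.card_univ, Fintype.card_fin,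
    ← Nat.cast_smul_eq_nsmul ℝ, smul_inv_smul₀ hn']

theorem uniformProfile_mem {s : Strat m} (hs : s ∈ aggregates n m) :
    uniformProfile n s ∈ profiles n m := fun _ => hs

theorem symm_uniformProfile (hn : 0 < n) (s : Strat m) :
    symm (uniformProfile n s) = uniformProfile n s := by
  unfold symm
  rw [agg_uniformProfile hn]
  rfl

theorem exists_ne_symm {s : Strat m} {S : Profile n m} (h : agg S = s)
    (hS : S ≠ uniformProfile n s) : ∃ i, S i ≠ symm S i := by
  by_contra! hcon
  exact hS (funext fun i => by rw [hcon i, symm, h, uniformProfile])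

theorem drift_neg (hg : g.Standing) (hP : ∀ x, Production (g.u x)) (Q : QuadraticForm g.c)
    (hn : 0 < n) {s : Strat m} (hs : s ∈ aggregates n m)
    (hmax : IsMaxOn (potential g n) (aggregates n m) s) {S : Profile n m}
    (hS : S ∈ profiles n m) (hne : S ≠ uniformProfile n s) :
    drift g ((n : ℝ)⁻¹ • s) S < 0 := by
  rw [drift_eq hP Q hn s hS]
  have h1 := fun i => response_nonpos hP Q hg.c_convex hn hS i
  rcases eq_or_ne (agg S) s with h | h
  · obtain ⟨i, hi⟩ := exists_ne_symm h hne
    have h2 := Finset.sum_lt_sum (fun i _ => h1 i)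
      ⟨i, Finset.mem_univ i, response_neg hg hP Q hn hS hi⟩
    rw [Finset.sum_const_zero] at h2
    rw [h, sub_self, inner_zero_right, zero_add]
    rwa [h] at h2
  · linarith [inner_potentialGrad_neg hg hP Q hn hs hmax (agg_mem_aggregates hn hS) h,
      Finset.sum_nonpos fun i (_ : i ∈ Finset.univ) => h1 i]

/-- All deviations vanish, so each payoff gradient is the gradient of the potential at its
maximizer; multiples `n • v` are aggregates, so the optimality of `s` can be tested against each
strategy `v`. -/
theorem isNash_uniformProfile (hg : g.Standing) (hP : ∀ x, Production (g.u x))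
    (Q : QuadraticForm g.c) (hn : 0 < n) {s : Strat m} (hs : s ∈ aggregates n m)
    (hmax : IsMaxOn (potential g n) (aggregates n m) s) : IsNash g (uniformProfile n s) := by
  have hn' : (0 : ℝ) < n := by positivity
  refine ⟨uniformProfile_mem hs, fun i v hv => ?_⟩
  refine (payoff_le_tangent hP Q hg.c_convex (uniformProfile_mem hs) i hv).trans ?_
  rw [gradPayoff_eq_response hP Q (uniformProfile_mem hs), symm_uniformProfile hn, sub_self,
    map_zero, add_zero, agg_uniformProfile hn]
  have h1 := inner_potentialGrad_nonpos hP Q hn hs hmax (smul_mem_aggregates hn hv)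
  have h2 : (n : ℝ) • v - s = (n : ℝ) • (v - uniformProfile n s i) := by
    rw [uniformProfile, smul_sub, smul_inv_smul₀ hn'.ne']
  rw [h2, inner_smul_right] at h1
  linarith [nonpos_of_mul_nonpos_right h1 hn']

/-- Testing the first-order conditions of an equilibrium against `s / n` gives nonnegative drift,
contrary to `drift_neg`. -/
theorem isNash_iff (hg : g.Standing) (hP : ∀ x, Production (g.u x))
    (Q : QuadraticForm g.c) (hn : 0 < n) {s : Strat m} (hs : s ∈ aggregates n m)
    (hmax : IsMaxOn (potential g n) (aggregates n m) s) (S : Profile n m) :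
    IsNash g S ↔ S = uniformProfile n s := by
  refine ⟨fun h => ?_, fun h => h ▸ isNash_uniformProfile hg hP Q hn hs hmax⟩
  by_contra hne
  refine (drift_neg hg hP Q hn hs hmax h.1 hne).not_ge (Finset.sum_nonneg fun i _ => ?_)
  have h1 := h.inner_nonpos hP Q i hs
  rw [← neg_sub, inner_neg_right] at h1
  linarith

/-! ### Projection onto tangent cones -/

theorem isNearest_iff {K : Set (Strat m)} (hK : Convex ℝ K) {f w : Strat m} :
    IsNearest K f w ↔ w ∈ K ∧ ∀ z ∈ K, ⟪f - w, z - w⟫ ≤ 0 := by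
  refine and_congr_right fun hw => ?_
  rw [← norm_eq_iInf_iff_real_inner_le_zero hK hw]
  have hbdd : BddBelow (range fun z : K => ‖f - z‖) :=
    ⟨0, by rintro _ ⟨y, rfl⟩; exact norm_nonneg _⟩
  have : Nonempty K := ⟨⟨w, hw⟩⟩
  constructor
  · exact fun h => le_antisymm (le_ciInf fun z => h z z.2) (ciInf_le hbdd ⟨w, hw⟩)
  · exact fun h z hz => h ▸ ciInf_le hbdd ⟨z, hz⟩

theorem sub_mem_tangentCone {v a : Strat m} (hv : v ∈ simplex m) (ha : a ∈ simplex m) :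
    a - v ∈ tangentCone v := by
  rw [mem_tangentCone_iff hv]
  refine ⟨by simp [ha.2, hv.2], fun x hx => ?_⟩
  simpa [hx] using ha.1 x

theorem smul_mem_tangentCone {v w : Strat m} (hv : v ∈ simplex m) (hw : w ∈ tangentCone v)
    {r : ℝ} (hr : 0 ≤ r) : r • w ∈ tangentCone v := by
  rw [mem_tangentCone_iff hv] at hw ⊢
  refine ⟨?_, fun x hx => mul_nonneg hr (hw.2 x hx)⟩
  simp [← Finset.mul_sum, hw.1]

theorem inner_sub_proj_self {v : Strat m} (hv : v ∈ simplex m) (f : Strat m) :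
    ⟪f - proj (tangentCone v) f, proj (tangentCone v) f⟫ = 0 := by
  obtain ⟨h1, h2⟩ := (isNearest_iff (convex_tangentCone hv)).1 (isNearest_proj hv f)
  -- In a cone the projection can be compared with its own multiples by `2` and `0`, which gives
  -- both signs.
  have h3 := h2 _ (smul_mem_tangentCone hv h1 (by norm_num : (0 : ℝ) ≤ 2))
  have h4 := h2 _ (smul_mem_tangentCone hv h1 (le_refl (0 : ℝ)))
  simp only [inner_sub_right, inner_smul_right] at h3 h4
  linarith

theorem inner_sub_proj_nonpos {v z : Strat m} (hv : v ∈ simplex m) (hz : z ∈ tangentCone v)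
    (f : Strat m) : ⟪f - proj (tangentCone v) f, z⟫ ≤ 0 := by
  have h1 := ((isNearest_iff (convex_tangentCone hv)).1 (isNearest_proj hv f)).2 z hz
  rw [inner_sub_right, inner_sub_proj_self hv, sub_zero] at h1
  exact h1

/-- The direction `a - v` is tangent at `v`, so projecting loses nothing of the pull towards `a`.
This handles the boundary of the simplex. -/
theorem inner_proj_sub_le {v a : Strat m} (hv : v ∈ simplex m) (ha : a ∈ simplex m)
    (f : Strat m) : ⟪proj (tangentCone v) f, v - a⟫ ≤ ⟪f, v - a⟫ := by
  have h1 := inner_sub_proj_nonpos hv (sub_mem_tangentCone hv ha) f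
  rw [← neg_sub v a, inner_neg_right, inner_sub_left] at h1
  linarith

/-! ### Stability through the squared distance -/

theorem absolutelyContinuousOnInterval_comp {X Y : Type*} [PseudoMetricSpace X]
    [PseudoMetricSpace Y] {f : ℝ → X} {φ : X → Y} {a b : ℝ} {A : Set X} {K : NNReal}
    (hf : AbsolutelyContinuousOnInterval f a b) (hφ : LipschitzOnWith K φ A)
    (hA : MapsTo f (uIcc a b) A) : AbsolutelyContinuousOnInterval (φ ∘ f) a b := by
  have hlim := Filter.Tendsto.const_mul (K : ℝ) hf
  rw [mul_zero] at hlim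
  refine squeeze_zero' (Eventually.of_forall fun _ => Finset.sum_nonneg fun _ _ => dist_nonneg)
    ?_ hlim
  filter_upwards [mem_inf_of_right (mem_principal_self _)] with E hE
  rw [Finset.mul_sum]
  exact Finset.sum_le_sum fun i hi =>
    hφ.dist_le_mul _ (hA (hE.1 i hi).1) _ (hA (hE.1 i hi).2)

theorem sub_le_of_deriv_le {f : ℝ → ℝ} {a b C : ℝ} (hab : a ≤ b)
    (hf : AbsolutelyContinuousOnInterval f a b)
    (hC : ∀ᵐ t ∂volume.restrict (Icc a b), deriv f t ≤ C) : f b - f a ≤ C * (b - a) := by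
  have h := intervalIntegral.integral_mono_ae_restrict hab hf.intervalIntegrable_deriv
    (intervalIntegrable_const (c := C)) hC
  rw [hf.integral_deriv_eq_sub] at h
  simpa [mul_comm] using h

theorem convex_profiles : Convex ℝ (profiles n m) :=
  fun _ hS _ hT _ _ hp hq hpq i => convex_simplex (hS i) (hT i) hp hq hpq

/-- The squared Euclidean distance to the profile in which every firm plays `a`. -/
def sqDist (a : Strat m) (S : Profile n m) : ℝ := ∑ i, ‖S i - a‖ ^ 2

theorem contDiff_sqDist (a : Strat m) : ContDiff ℝ 1 (sqDist (n := n) a) :=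
  ContDiff.sum fun i _ => ((contDiff_apply ℝ (Strat m) i).sub contDiff_const).norm_sq ℝ

theorem hasDerivAt_sqDist (a : Strat m) {S : ℝ → Profile n m} {v : Profile n m} {t : ℝ}
    (h : HasDerivAt S v t) :
    HasDerivAt (sqDist a ∘ S) (∑ i, 2 * ⟪S t i - a, v i⟫) t :=
  HasDerivAt.fun_sum (u := Finset.univ) (A := fun i τ => ‖S τ i - a‖ ^ 2) fun i _ =>
    ((hasDerivAt_pi.1 h i).sub_const a).norm_sq

namespace IsTrajectory

variable {S : ℝ → Profile n m}

theorem absolutelyContinuous_sqDist (h : IsTrajectory g S) (a : Strat m) {r t : ℝ} (hr : 0 ≤ r)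
    (ht : 0 ≤ t) : AbsolutelyContinuousOnInterval (sqDist a ∘ S) r t := by
  obtain ⟨K, hK⟩ := (contDiff_sqDist (n := n) a).contDiffOn.exists_lipschitzOnWith (by simp)
    convex_profiles isCompact_profiles
  have hsub : uIcc r t ⊆ uIcc 0 (max r t) := by
    rw [uIcc_of_le (le_max_of_le_left hr), uIcc]
    exact Icc_subset_Icc (le_min hr ht) le_rfl
  refine absolutelyContinuousOnInterval_comp
    ((h.absCont (max r t) (le_max_of_le_left hr)).mono hsub) hK fun τ hτ => h.mem τ ?_
  exact (le_min hr ht).trans hτ.1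

theorem ae_deriv_sqDist_le (h : IsTrajectory g S) {a : Strat m} (ha : a ∈ simplex m) :
    ∀ᵐ t ∂volume.restrict (Ici (0 : ℝ)), deriv (sqDist a ∘ S) t ≤ 2 * drift g a (S t) := by
  filter_upwards [h.ode, ae_restrict_mem measurableSet_Ici] with t ht ht0
  rw [(hasDerivAt_sqDist a ht).deriv, drift, Finset.mul_sum]
  refine Finset.sum_le_sum fun i _ => ?_
  rw [real_inner_comm]
  exact mul_le_mul_of_nonneg_left (inner_proj_sub_le (h.mem t ht0 i) ha _) (by norm_num)

theorem sqDist_sub_le (h : IsTrajectory g S) {a : Strat m} (ha : a ∈ simplex m) {r t C : ℝ}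
    (hr : 0 ≤ r) (hrt : r ≤ t) (hC : ∀ τ, 0 ≤ τ → drift g a (S τ) ≤ C) :
    sqDist a (S t) - sqDist a (S r) ≤ 2 * C * (t - r) := by
  refine sub_le_of_deriv_le hrt (h.absolutelyContinuous_sqDist a hr (hr.trans hrt)) ?_
  have hsub : Icc r t ⊆ Ici 0 := fun τ hτ => hr.trans hτ.1
  filter_upwards [ae_restrict_of_ae_restrict_of_subset hsub (h.ae_deriv_sqDist_le ha),
    ae_restrict_mem measurableSet_Icc] with τ hτ hτ'
  exact hτ.trans (mul_le_mul_of_nonneg_left (hC τ (hsub hτ')) (by norm_num))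

end IsTrajectory

theorem continuousOn_drift (hP : ∀ x, Production (g.u x)) (Q : QuadraticForm g.c)
    (a : Strat m) : ContinuousOn (drift (n := n) g a) (profiles n m) :=
  continuousOn_finsetSum _ fun i _ => (continuousOn_gradPayoff hP Q i).inner
    ((continuous_apply i).sub continuous_const).continuousOn

theorem dist_lt_of_sqDist_lt {a : Strat m} {S : Profile n m} {ε : ℝ} (hε : 0 < ε)
    (h : sqDist a S < ε ^ 2) : dist S (fun _ => a) < ε := by
  rw [dist_pi_lt_iff hε]
  intro i
  rw [dist_eq_norm]
  refine lt_of_pow_lt_pow_left₀ 2 hε.le (lt_of_le_of_lt ?_ h)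
  exact Finset.single_le_sum (f := fun i => ‖S i - a‖ ^ 2) (fun _ _ => sq_nonneg _)
    (Finset.mem_univ i)

theorem sqDist_le (a : Strat m) (S : Profile n m) :
    sqDist a S ≤ n * dist S (fun _ => a) ^ 2 := by
  have h : ∀ i ∈ Finset.univ, ‖S i - a‖ ^ 2 ≤ dist S (fun _ => a) ^ 2 := fun i _ => by
    rw [← dist_eq_norm]
    exact pow_le_pow_left₀ dist_nonneg (dist_le_pi_dist S (fun _ => a) i) 2
  simpa [sqDist] using Finset.sum_le_card_nsmul _ _ _ h

/-- A profile in which all firms play `a` is stable and attractive if the payoff gradients point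
towards it. -/
theorem stable_of_drift_neg (hP : ∀ x, Production (g.u x)) (Q : QuadraticForm g.c) (hn : 0 < n)
    {a : Strat m} (ha : a ∈ simplex m)
    (hdrift : ∀ S ∈ profiles n m, S ≠ (fun _ => a) → drift g a S < 0) :
    (∀ ε > 0, ∃ δ > 0, ∀ S : ℝ → Profile n m, IsTrajectory g S →
      dist (S 0) (fun _ => a) < δ → ∀ t, 0 ≤ t → dist (S t) (fun _ => a) < ε) ∧
    ∀ S : ℝ → Profile n m, IsTrajectory g S → Tendsto S atTop (𝓝 fun _ => a) := by
  have hself : sqDist (n := n) a (fun _ => a) = 0 := by simp [sqDist]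
  have hnonpos : ∀ S ∈ profiles n m, drift g a S ≤ 0 := fun S hS => by
    rcases eq_or_ne S (fun _ => a) with rfl | h
    · simp [drift]
    · exact (hdrift S hS h).le
  have hmono : ∀ S : ℝ → Profile n m, IsTrajectory g S → ∀ r t, 0 ≤ r → r ≤ t →
      sqDist a (S t) ≤ sqDist a (S r) := fun S hS r t hr hrt => by
    have := hS.sqDist_sub_le ha hr hrt (C := 0) fun τ hτ => hnonpos _ (hS.mem τ hτ)
    linarith
  -- Profiles carry the sup distance, so `sqDist` is at most `n (ε / n)² = ε² / n ≤ ε²` at the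
  -- start.
  refine ⟨fun ε hε => ⟨ε / n, by positivity, fun S hS h0 t ht => ?_⟩, fun S hS => ?_⟩
  · refine dist_lt_of_sqDist_lt hε ((hmono S hS 0 t le_rfl ht).trans_lt ?_)
    have hn1 : (1 : ℝ) ≤ n := by exact_mod_cast hn
    calc sqDist a (S 0) ≤ n * dist (S 0) (fun _ => a) ^ 2 := sqDist_le a _
      _ < n * (ε / n) ^ 2 := by gcongr
      _ = ε ^ 2 / n := by field_simp
      _ ≤ ε ^ 2 := div_le_self (sq_nonneg ε) hn1
  · rw [Metric.tendsto_atTop]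
    intro ε hε
    obtain ⟨r, hr, hlt⟩ : ∃ r, 0 ≤ r ∧ sqDist a (S r) < ε ^ 2 := by
      -- If the distance never dropped below `ε`, compactness would bound the drift away from zero.
      by_contra! hcon
      have hK : IsCompact (profiles n m ∩ {T | ε ^ 2 ≤ sqDist a T}) :=
        isCompact_profiles.inter_right
          (isClosed_le continuous_const (contDiff_sqDist a).continuous)
      obtain ⟨T, hT, hmax⟩ := hK.exists_isMaxOn ⟨S 0, hS.mem 0 le_rfl, hcon 0 le_rfl⟩
        ((continuousOn_drift hP Q a).mono inter_subset_left)
      have hneg : drift g a T < 0 := hdrift T hT.1 fun h => by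
        have h2 : ε ^ 2 ≤ sqDist a T := hT.2
        rw [h, hself] at h2
        exact absurd h2 (not_le.2 (by positivity))
      -- By this time the linear bound on the squared distance has fallen to `0`.
      have ht : 0 ≤ sqDist a (S 0) / (-2 * drift g a T) :=
        div_nonneg (Finset.sum_nonneg fun _ _ => sq_nonneg _) (by linarith)
      have h1 := hS.sqDist_sub_le ha le_rfl ht (C := drift g a T)
        fun τ hτ => hmax ⟨hS.mem τ hτ, hcon τ hτ⟩
      have h2 : 2 * drift g a T * (sqDist a (S 0) / (-2 * drift g a T) - 0) =
          -sqDist a (S 0) := by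
        have := hneg.ne
        field_simp
        ring
      have h3 := hcon _ ht
      have h4 : 0 < ε ^ 2 := by positivity
      linarith
    refine ⟨r, fun t ht => dist_lt_of_sqDist_lt hε ((hmono S hS r t hr ht).trans_lt hlt)⟩

/-! ### Existence of trajectories by a projected Euler scheme -/

theorem proj_simplex (hm : 0 < m) (f : Strat m) :
    proj (simplex m) f ∈ simplex m ∧
      ∀ z ∈ simplex m, ⟪f - proj (simplex m) f, z - proj (simplex m) f⟫ ≤ 0 := by
  obtain ⟨w, hw, h⟩ := exists_norm_eq_iInf_of_complete_convex (simplex_nonempty hm)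
    isCompact_simplex.isComplete convex_simplex f
  have hnear : IsNearest (simplex m) f w := (isNearest_iff convex_simplex).2
    ⟨hw, (norm_eq_iInf_iff_real_inner_le_zero convex_simplex hw).1 h⟩
  exact (isNearest_iff convex_simplex).1 (Classical.epsilon_spec ⟨w, hnear⟩)

/-- The projected Euler scheme with step `h` for the field `F`. -/
def euler (F : Fin n → Profile n m → Strat m) (S₀ : Profile n m) (h : ℝ) : ℕ → Profile n m
  | 0 => S₀
  | k + 1 => fun i => proj (simplex m) (euler F S₀ h k i + h • F i (euler F S₀ h k))

section Euler

variable {F : Fin n → Profile n m → Strat m} {S₀ : Profile n m} {h M : ℝ}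

theorem euler_mem (hm : 0 < m) (hS₀ : S₀ ∈ profiles n m) (k : ℕ) :
    euler F S₀ h k ∈ profiles n m := by
  cases k with
  | zero => exact hS₀
  | succ k => exact fun i => (proj_simplex hm _).1

theorem inner_euler_le (hm : 0 < m) (k : ℕ) (i : Fin n) {z : Strat m} (hz : z ∈ simplex m) :
    ⟪euler F S₀ h (k + 1) i - euler F S₀ h k i, euler F S₀ h (k + 1) i - z⟫ ≤
      h * ⟪F i (euler F S₀ h k), euler F S₀ h (k + 1) i - z⟫ := by
  have h1 := (proj_simplex hm (euler F S₀ h k i + h • F i (euler F S₀ h k))).2 z hz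
  change ⟪_ - euler F S₀ h (k + 1) i, z - euler F S₀ h (k + 1) i⟫ ≤ 0 at h1
  rw [← neg_sub _ z, inner_neg_right, sub_eq_add_neg, add_right_comm, ← sub_eq_add_neg,
    inner_add_left, inner_smul_left, ← neg_sub, inner_neg_left] at h1
  simp only [conj_trivial] at h1
  linarith

theorem norm_euler_sub_le (hm : 0 < m) (hS₀ : S₀ ∈ profiles n m) (hh : 0 ≤ h)
    (hM : ∀ i, ∀ S ∈ profiles n m, ‖F i S‖ ≤ M) (k : ℕ) (i : Fin n) :
    ‖euler F S₀ h (k + 1) i - euler F S₀ h k i‖ ≤ h * M := by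
  have h1 := inner_euler_le (F := F) (S₀ := S₀) (h := h) hm k i
    (euler_mem (F := F) (h := h) hm hS₀ k i)
  set d := euler F S₀ h (k + 1) i - euler F S₀ h k i
  have h2 := real_inner_le_norm (F i (euler F S₀ h k)) d
  have h3 := mul_le_mul_of_nonneg_right (hM i _ (euler_mem (F := F) (h := h) hm hS₀ k))
    (norm_nonneg d)
  rw [real_inner_self_eq_norm_sq] at h1
  have h4 : ‖d‖ ^ 2 ≤ h * (M * ‖d‖) := h1.trans (mul_le_mul_of_nonneg_left (h2.trans h3) hh)
  rcases (norm_nonneg d).eq_or_lt with h0 | h0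
  · rw [← h0]
    exact mul_nonneg hh ((norm_nonneg _).trans (hM i _ hS₀))
  · refine le_of_mul_le_mul_right ?_ h0
    linarith

theorem dist_euler_le (hm : 0 < m) (hS₀ : S₀ ∈ profiles n m) (hh : 0 ≤ h) (hM0 : 0 ≤ M)
    (hM : ∀ i, ∀ S ∈ profiles n m, ‖F i S‖ ≤ M) {j k : ℕ} (hjk : j ≤ k) :
    dist (euler F S₀ h j) (euler F S₀ h k) ≤ (k - j) * (h * M) := by
  have h1 := dist_le_Ico_sum_of_dist_le (f := euler F S₀ h) (d := fun _ => h * M) hjk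
    fun {l} _ _ => by
      rw [dist_comm, dist_pi_le_iff (mul_nonneg hh hM0)]
      intro i
      rw [dist_eq_norm]
      exact norm_euler_sub_le hm hS₀ hh hM l i
  simpa [Nat.cast_sub hjk] using h1

/-- Discrete form of `d/dt ½‖γ - z‖² ≤ ⟪F, γ - z⟫`. Summed over steps, it survives pointwise limits
of the scheme, so no convergence of velocities is needed. -/
theorem norm_sq_euler_succ_le (hm : 0 < m) (k : ℕ) (i : Fin n) {z : Strat m}
    (hz : z ∈ simplex m) :
    1 / 2 * ‖euler F S₀ h (k + 1) i - z‖ ^ 2 ≤ 1 / 2 * ‖euler F S₀ h k i - z‖ ^ 2 +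
      h * ⟪F i (euler F S₀ h k), euler F S₀ h (k + 1) i - z⟫ := by
  have h1 := inner_euler_le (F := F) (S₀ := S₀) (h := h) hm k i hz
  have h2 := norm_sub_sq_real (euler F S₀ h (k + 1) i - z)
    (euler F S₀ h (k + 1) i - euler F S₀ h k i)
  rw [sub_sub_sub_cancel_left, real_inner_comm] at h2
  have h3 := norm_sub_rev z (euler F S₀ h k i)
  have h4 := sq_nonneg ‖euler F S₀ h (k + 1) i - euler F S₀ h k i‖
  rw [norm_sub_rev (euler F S₀ h k i) z] at *
  nlinarith

theorem norm_sq_euler_le (hm : 0 < m) (hh : 0 ≤ h) (i : Fin n) {z : Strat m}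
    (hz : z ∈ simplex m) {C : ℝ} {j k : ℕ} (hjk : j ≤ k)
    (hC : ∀ l, j ≤ l → l < k → ⟪F i (euler F S₀ h l), euler F S₀ h (l + 1) i - z⟫ ≤ C) :
    1 / 2 * ‖euler F S₀ h k i - z‖ ^ 2 ≤ 1 / 2 * ‖euler F S₀ h j i - z‖ ^ 2 +
      (k - j) * h * C := by
  induction k, hjk using Nat.le_induction with
  | base => simp
  | succ k hjk ih =>
    have h1 := ih fun l hl hl' => hC l hl (hl'.trans (Nat.lt_succ_self k))
    have h2 := norm_sq_euler_succ_le (F := F) (S₀ := S₀) (h := h) hm k i hz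
    have h3 := mul_le_mul_of_nonneg_left (hC k hjk (Nat.lt_succ_self k)) hh
    push_cast
    linarith

end Euler

/-- The piecewise constant interpolation of the projected Euler scheme with step `1 / (N + 1)`. -/
def eulerPath (F : Fin n → Profile n m → Strat m) (S₀ : Profile n m) (N : ℕ) (t : ℝ) :
    Profile n m :=
  euler F S₀ (1 / ((N : ℝ) + 1)) ⌊t * ((N : ℝ) + 1)⌋₊

theorem floor_sub_floor_le {a b : ℝ} (hab : a ≤ b) :
    ((⌊b⌋₊ : ℝ) - ⌊a⌋₊) ≤ b - a + 1 := by
  rcases le_total 0 b with hb | hb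
  · linarith [Nat.floor_le hb, Nat.lt_floor_add_one a]
  · rw [Nat.floor_of_nonpos hb, Nat.floor_of_nonpos (hab.trans hb)]
    linarith

theorem dist_eulerPath_le {F : Fin n → Profile n m → Strat m} {S₀ : Profile n m} {M : ℝ}
    (hm : 0 < m) (hS₀ : S₀ ∈ profiles n m) (hM0 : 0 ≤ M)
    (hM : ∀ i, ∀ S ∈ profiles n m, ‖F i S‖ ≤ M) (N : ℕ) {r t : ℝ} (hrt : r ≤ t) :
    dist (eulerPath F S₀ N r) (eulerPath F S₀ N t) ≤ M * (t - r + 1 / ((N : ℝ) + 1)) := by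
  have hN : (0 : ℝ) < (N : ℝ) + 1 := by positivity
  have h1 : r * ((N : ℝ) + 1) ≤ t * ((N : ℝ) + 1) := by gcongr
  refine (dist_euler_le hm hS₀ (by positivity) hM0 hM (Nat.floor_mono h1)).trans ?_
  calc _ ≤ (t * ((N : ℝ) + 1) - r * ((N : ℝ) + 1) + 1) * (1 / ((N : ℝ) + 1) * M) := by
        gcongr
        exact floor_sub_floor_le h1
    _ = M * (t - r + 1 / ((N : ℝ) + 1)) := by field_simp

theorem deriv_le_of_sub_le {f : ℝ → ℝ} {f' r δ C : ℝ} (hf : HasDerivAt f f' r) (hδ : 0 < δ)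
    (h : ∀ t, r ≤ t → t ≤ r + δ → f t ≤ f r + (t - r) * C) : f' ≤ C := by
  have h1 := hasDerivWithinAt_iff_tendsto_slope.1 (hf.hasDerivWithinAt (s := Ici r))
  rw [Ici_sdiff_left] at h1
  refine le_of_tendsto h1 ?_
  filter_upwards [Ioc_mem_nhdsGT (show r < r + δ by linarith)] with t ht
  rw [slope_def_field, div_le_iff₀ (by linarith [ht.1])]
  linarith [h t ht.1.le ht.2]

/-- A curve in the simplex with velocity `v` at an interior time satisfying the variational
inequality of the field value `f` moves with the projection of `f` to the tangent cone. -/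
theorem eq_proj_of_variational {γ : ℝ → Strat m} {f v : Strat m} {r : ℝ}
    (hγ : ∀ t, γ t ∈ simplex m) (hd : HasDerivAt γ v r)
    (hvar : ∀ z ∈ simplex m, ⟪v, γ r - z⟫ ≤ ⟪f, γ r - z⟫) :
    v = proj (tangentCone (γ r)) f := by
  have hcoord : ∀ x, HasDerivAt (fun t => γ t x) (v x) r := fun x =>
    (EuclideanSpace.proj (𝕜 := ℝ) x).hasFDerivAt.comp_hasDerivAt r hd
  have hsum : ∑ x, v x = 0 := by
    have h1 := HasDerivAt.fun_sum (u := Finset.univ) fun x _ => hcoord x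
    simp only [(hγ _).2] at h1
    exact h1.unique (hasDerivAt_const r 1)
  -- The derivative is two-sided, so a coordinate that vanishes at time `r` is at a minimum. Hence
  -- `-v` is tangent too, and `f - v` is orthogonal to `v`.
  have hzero : ∀ x, γ r x = 0 → v x = 0 := fun x hx => by
    refine IsLocalMin.hasDerivAt_eq_zero (Eventually.of_forall fun t => ?_) (hcoord x)
    rw [hx]
    exact (hγ t).1 x
  have hmem : v ∈ tangentCone (γ r) :=
    (mem_tangentCone_iff (hγ r) v).2 ⟨hsum, fun x hx => (hzero x hx).ge⟩
  have hmem' : -v ∈ tangentCone (γ r) :=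
    (mem_tangentCone_iff (hγ r) _).2 ⟨by simp [hsum], fun x hx => by simp [hzero x hx]⟩
  have hpolar : ∀ w ∈ tangentCone (γ r), ⟪f - v, w⟫ ≤ 0 := by
    intro w hw
    obtain ⟨α, l, hl, c, d, -, hd', hlim⟩ := exists_fun_of_mem_tangentConeAt hw
    refine le_of_tendsto (tendsto_const_nhds.inner hlim) ?_
    filter_upwards [hd'] with k hk
    have h1 := hvar _ hk
    rw [sub_add_cancel_left, inner_neg_right, inner_neg_right] at h1
    have h2 : ⟪f - v, d k⟫ ≤ 0 := by
      rw [inner_sub_left]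
      linarith
    have h3 : ⟪f - v, c k • d k⟫ = (c k : ℝ) * ⟪f - v, d k⟫ := inner_smul_right _ _ (c k : ℝ)
    rw [h3]
    exact mul_nonpos_of_nonneg_of_nonpos (c k).2 h2
  have h1 := hpolar _ hmem
  have h2 := hpolar _ hmem'
  rw [inner_neg_right] at h2
  refine isNearest_unique (hγ r)
    ((isNearest_iff (convex_tangentCone (hγ r))).2 ⟨hmem, fun w hw => ?_⟩) (isNearest_proj (hγ r) f)
  rw [inner_sub_right]
  linarith [hpolar w hw]

/-- Existence of Lipschitz solutions of projected dynamical systems on products of simplices with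
a continuous field. -/
theorem exists_projected_solution (hm : 0 < m) {F : Fin n → Profile n m → Strat m}
    (hF : ∀ i, ContinuousOn (F i) (profiles n m)) {S₀ : Profile n m} (hS₀ : S₀ ∈ profiles n m) :
    ∃ S : ℝ → Profile n m, (∀ t, S t ∈ profiles n m) ∧ (∃ K, LipschitzWith K S) ∧ S 0 = S₀ ∧
      ∀ r, 0 ≤ r → ∀ v, HasDerivAt S v r → ∀ i, v i = proj (tangentCone (S r i)) (F i (S r)) := by
  obtain ⟨M, hM0, hM⟩ : ∃ M, 0 ≤ M ∧ ∀ i, ∀ S ∈ profiles n m, ‖F i S‖ ≤ M := by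
    obtain ⟨C, hC⟩ := isCompact_profiles.exists_bound_of_continuousOn (continuousOn_pi.2 hF)
    exact ⟨max C 0, le_max_right _ _, fun i S hS =>
      ((norm_le_pi_norm (fun i => F i S) i).trans (hC S hS)).trans (le_max_left _ _)⟩
  have hmemN : ∀ N t, eulerPath F S₀ N t ∈ profiles n m := fun N t => euler_mem hm hS₀ _
  -- An ultrafilter gives limits at all times at once, without choosing subsequences. For `t < 0`
  -- the floor is `0` and the path rests at `S₀`.
  have hex : ∀ t, ∃ T ∈ profiles n m,
      Tendsto (fun N => eulerPath F S₀ N t) (hyperfilter ℕ) (𝓝 T) := fun t =>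
    isCompact_profiles.ultrafilter_le_nhds ((hyperfilter ℕ).map fun N => eulerPath F S₀ N t)
      (le_principal_iff.2 (mem_map.2 (Eventually.of_forall fun N => hmemN N t)))
  choose S hmem hlim using hex
  have hstep : Tendsto (fun N : ℕ => 1 / ((N : ℝ) + 1)) (hyperfilter ℕ) (𝓝 0) :=
    tendsto_one_div_add_atTop_nhds_zero_nat.mono_left Nat.hyperfilter_le_atTop
  have hfloor : ∀ t, 0 ≤ t → Tendsto
      (fun N : ℕ => (⌊t * ((N : ℝ) + 1)⌋₊ : ℝ) * (1 / ((N : ℝ) + 1))) (hyperfilter ℕ) (𝓝 t) := by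
    intro t ht
    have h1 := ((tendsto_nat_floor_mul_div_atTop ht).comp
      (tendsto_atTop_add_const_right _ (1 : ℝ) tendsto_natCast_atTop_atTop)).mono_left
      Nat.hyperfilter_le_atTop
    refine h1.congr fun N => ?_
    simp [div_eq_mul_inv]
  have hlip : ∀ r t, r ≤ t → dist (S r) (S t) ≤ M * (t - r) := by
    intro r t hrt
    have h1 : Tendsto (fun N : ℕ => M * (t - r + 1 / ((N : ℝ) + 1))) (hyperfilter ℕ)
        (𝓝 (M * (t - r))) := by
      simpa using (hstep.const_add (t - r)).const_mul M
    exact le_of_tendsto_of_tendsto ((hlim r).dist (hlim t)) h1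
      (Eventually.of_forall fun N => dist_eulerPath_le hm hS₀ hM0 hM N hrt)
  have hlipschitz : LipschitzWith ⟨M, hM0⟩ S := LipschitzWith.of_dist_le_mul fun r t => by
    rcases le_total r t with hrt | hrt
    · rw [dist_comm r t, Real.dist_eq, abs_of_nonneg (sub_nonneg.2 hrt)]
      exact hlip r t hrt
    · rw [dist_comm, Real.dist_eq, abs_of_nonneg (sub_nonneg.2 hrt)]
      exact hlip t r hrt
  refine ⟨S, hmem, ⟨_, hlipschitz⟩, tendsto_nhds_unique (hlim 0) ?_, fun r hr v hv i => ?_⟩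
  · simp only [eulerPath, zero_mul, Nat.floor_zero, euler]
    exact tendsto_const_nhds
  refine eq_proj_of_variational (γ := fun t => S t i) (fun t => hmem t i)
    (hasDerivAt_pi.1 hv i) fun z hz => ?_
  refine le_of_forall_pos_le_add fun ε hε => ?_
  obtain ⟨ρ, hρ, hclose⟩ : ∃ ρ > 0, ∀ T ∈ profiles n m, ∀ T' ∈ profiles n m,
      dist T (S r) < ρ → dist T' (S r) < ρ →
      ⟪F i T, T' i - z⟫ ≤ ⟪F i (S r), S r i - z⟫ + ε := by
    have hcont : ContinuousWithinAt (fun p : Profile n m × Profile n m => ⟪F i p.1, p.2 i - z⟫)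
        (profiles n m ×ˢ profiles n m) (S r, S r) := by
      refine ContinuousWithinAt.inner ?_ ?_
      · exact ContinuousWithinAt.comp (t := profiles n m) (hF i (S r) (hmem r))
          continuousWithinAt_fst fun p hp => hp.1
      · exact Continuous.continuousWithinAt (by fun_prop)
    obtain ⟨ρ, hρ, h⟩ := Metric.continuousWithinAt_iff.1 hcont ε hε
    refine ⟨ρ, hρ, fun T hT T' hT' h1 h2 => ?_⟩
    have h3 := h (x := (T, T')) ⟨hT, hT'⟩ (by rw [Prod.dist_eq]; exact max_lt h1 h2)
    rw [Real.dist_eq] at h3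
    linarith [(abs_lt.1 h3).2]
  have hderiv : HasDerivAt (fun t => 1 / 2 * ‖S t i - z‖ ^ 2) ⟪v i, S r i - z⟫ r := by
    refine ((((hasDerivAt_pi.1 hv i).sub_const z).norm_sq).const_mul (1 / 2)).congr_deriv ?_
    rw [real_inner_comm]
    ring
  -- Three errors of at most `ρ / 4` keep the iterates within `ρ` of `S r`: the motion during this
  -- time, one step, and the limit at time `r`. The `+ 1` covers `M = 0`.
  refine deriv_le_of_sub_le hderiv (δ := ρ / (4 * (M + 1))) (by positivity) fun t hrt htr => ?_
  have hfun : ∀ t, Tendsto (fun N => 1 / 2 * ‖eulerPath F S₀ N t i - z‖ ^ 2) (hyperfilter ℕ)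
      (𝓝 (1 / 2 * ‖S t i - z‖ ^ 2)) := fun t =>
    ((((tendsto_pi_nhds.1 (hlim t) i).sub_const z).norm).pow 2).const_mul _
  refine le_of_tendsto_of_tendsto (hfun t) ((hfun r).add
    (((hfloor t (hr.trans hrt)).sub (hfloor r hr)).mul_const _)) ?_
  have hρ4 : 0 < ρ / 4 := by positivity
  have hMstep : Tendsto (fun N : ℕ => M * (1 / ((N : ℝ) + 1))) (hyperfilter ℕ) (𝓝 0) := by
    simpa using hstep.const_mul M
  filter_upwards [Metric.tendsto_nhds.1 (hlim r) _ hρ4, hMstep.eventually_lt_const hρ4]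
    with N hN1 hN2
  have hN : (0 : ℝ) < (N : ℝ) + 1 := by positivity
  have hfl : r * ((N : ℝ) + 1) ≤ t * ((N : ℝ) + 1) := by gcongr
  have hM4 : M * (t - r) ≤ ρ / 4 := by
    calc M * (t - r) ≤ (M + 1) * (ρ / (4 * (M + 1))) := by
          gcongr
          · linarith
          · linarith
      _ = ρ / 4 := by field_simp
  have hnear : ∀ l, ⌊r * ((N : ℝ) + 1)⌋₊ ≤ l → l ≤ ⌊t * ((N : ℝ) + 1)⌋₊ →
      dist (euler F S₀ (1 / ((N : ℝ) + 1)) l) (S r) < ρ := by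
    intro l hl hl'
    have h1 := dist_euler_le (F := F) (h := 1 / ((N : ℝ) + 1)) hm hS₀ (by positivity) hM0 hM hl
    have h2 : (l : ℝ) ≤ ⌊t * ((N : ℝ) + 1)⌋₊ := by exact_mod_cast hl'
    have h3 := floor_sub_floor_le hfl
    have h4 : ((l : ℝ) - ⌊r * ((N : ℝ) + 1)⌋₊) * (1 / ((N : ℝ) + 1) * M) ≤
        (t * ((N : ℝ) + 1) - r * ((N : ℝ) + 1) + 1) * (1 / ((N : ℝ) + 1) * M) := by
      gcongr
      linarith
    have h5 : (t * ((N : ℝ) + 1) - r * ((N : ℝ) + 1) + 1) * (1 / ((N : ℝ) + 1) * M) =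
        M * (t - r) + M * (1 / ((N : ℝ) + 1)) := by field_simp
    have h6 := dist_triangle (euler F S₀ (1 / ((N : ℝ) + 1)) l) (eulerPath F S₀ N r) (S r)
    rw [dist_comm] at h1
    unfold eulerPath at h6 hN1
    linarith
  -- The estimate pairs the field at iterate `l` with the position of iterate `l + 1`, so both must
  -- be close to `S r`.
  have h1 := norm_sq_euler_le (F := F) (S₀ := S₀) (h := 1 / ((N : ℝ) + 1)) hm (by positivity) i hz
    (Nat.floor_mono hfl) fun l hl hl' => hclose _ (euler_mem hm hS₀ l) _ (euler_mem hm hS₀ (l + 1))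
      (hnear l hl hl'.le) (hnear (l + 1) (by lia) hl')
  rw [← sub_mul]
  exact h1

/-- A Lipschitz curve is differentiable almost everywhere, and wherever it is, its derivative is the
projected gradient. -/
theorem exists_trajectory (hP : ∀ x, Production (g.u x)) (Q : QuadraticForm g.c) (hm : 0 < m)
    {S₀ : Profile n m} (hS₀ : S₀ ∈ profiles n m) :
    ∃ S : ℝ → Profile n m, IsTrajectory g S ∧ S 0 = S₀ := by
  obtain ⟨S, hmem, ⟨K, hK⟩, h0, hv⟩ :=
    exists_projected_solution hm (continuousOn_gradPayoff hP Q) hS₀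
  refine ⟨S, ⟨fun t _ => hmem t, fun T _ => hK.lipschitzOnWith.absolutelyContinuousOnInterval,
    ?_⟩, h0⟩
  filter_upwards [ae_restrict_of_ae hK.ae_differentiableAt_real,
    ae_restrict_mem measurableSet_Ici] with t ht ht0
  have h1 : velocity g (S t) = deriv S t := funext fun i => (hv t ht0 _ ht.hasDerivAt i).symm
  rw [h1]
  exact ht.hasDerivAt

/-! ### The Lyapunov function `V` -/

theorem contDiffOn_lyapunov (hP : ∀ x, Production (g.u x)) (Q : QuadraticForm g.c)
    (T : Profile n m) : ContDiffOn ℝ 1 (lyapunov g T) (profiles n m) := by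
  have hagg : ContDiff ℝ 1 (agg : Profile n m → Strat m) :=
    ContDiff.sum fun i _ => contDiff_apply ℝ (Strat m) i
  have hcost : ContDiff ℝ 1 g.c := by
    have h : g.c = fun v => 1 / 2 * ⟪Q.lin v, v⟫ + ⟪Q.shift, v⟫ + Q.const := funext Q.eq
    rw [h]
    exact ((contDiff_const.mul (Q.lin.contDiff.inner ℝ contDiff_id)).add
      (contDiff_const.inner ℝ contDiff_id)).add contDiff_const
  refine (contDiffOn_const.sub (ContDiffOn.sub (ContDiffOn.sum fun x _ => ?_) ?_)).add
    (ContDiff.contDiffOn (ContDiff.sum fun i _ => ?_))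
  · exact ((hP x).contDiffOn_marketPotential n).comp
      ((EuclideanSpace.proj (𝕜 := ℝ) x).contDiff.comp hagg).contDiffOn fun S hS => agg_nonneg hS x
  · exact (contDiff_const.mul (hcost.comp (hagg.const_smul _))).contDiffOn
  · exact ((contDiff_apply ℝ (Strat m) i).sub (hagg.const_smul _)).norm_sq ℝ

theorem lyapunov_uniformProfile (hn : 0 < n) (s : Strat m) :
    lyapunov g (uniformProfile n s) (uniformProfile n s) = 0 := by
  simp [lyapunov, symm_uniformProfile hn]

theorem lyapunov_pos (hg : g.Standing) (hP : ∀ x, Production (g.u x)) (Q : QuadraticForm g.c)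
    (hn : 0 < n) {s : Strat m} (hs : s ∈ aggregates n m)
    (hmax : IsMaxOn (potential g n) (aggregates n m) s) {S : Profile n m}
    (hS : S ∈ profiles n m) (hne : S ≠ uniformProfile n s) :
    0 < lyapunov g (uniformProfile n s) S := by
  unfold lyapunov
  rw [agg_uniformProfile hn]
  rcases eq_or_ne (agg S) s with h | h
  · obtain ⟨i, hi⟩ := exists_ne_symm h hne
    rw [h, sub_self, zero_add]
    have h1 := norm_pos_iff.2 (sub_ne_zero.2 hi)
    exact Finset.sum_pos' (fun _ _ => sq_nonneg _) ⟨i, Finset.mem_univ i, by positivity⟩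
  · exact add_pos_of_pos_of_nonneg
      (sub_pos.2 (potential_lt_max hg hP Q hn hs hmax (agg_mem_aggregates hn hS) h))
      (Finset.sum_nonneg fun _ _ => sq_nonneg _)

theorem agg_add_smul (S v : Profile n m) (t : ℝ) : agg (S + t • v) = agg S + t • agg v := by
  simp [agg, Finset.sum_add_distrib, Finset.smul_sum]

theorem sum_inner_symm (hn : 0 < n) (S v : Profile n m) :
    ∑ i, ⟪S i - symm S i, v i - symm v i⟫ = ∑ i, ⟪S i - symm S i, v i⟫ := by
  simp only [inner_sub_right _ (v _), Finset.sum_sub_distrib]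
  rw [sub_eq_self]
  have h : ∀ i, symm v i = (n : ℝ)⁻¹ • agg v := fun _ => rfl
  simp only [h]
  rw [← sum_inner, sum_deviation hn, inner_zero_left]

theorem hasLineDerivAt_lyapunov (hP : ∀ x, Production (g.u x)) (Q : QuadraticForm g.c)
    (hn : 0 < n) (T v : Profile n m) {S : Profile n m} (hpos : ∀ i x, 0 < S i x) :
    HasLineDerivAt ℝ (lyapunov g T)
      (-⟪potentialGrad Q n (agg S), agg v⟫ + 2 * ∑ i, ⟪S i - symm S i, v i⟫) S v := by
  have hagg : ∀ x, 0 < agg S x := fun x => by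
    rw [agg_apply]
    exact Finset.sum_pos (fun i _ => hpos i x) ⟨⟨0, hn⟩, Finset.mem_univ _⟩
  -- Positive aggregates stay nonnegative for small `τ` of either sign, so the one-sided derivative
  -- of the potential becomes two-sided.
  have h1 : {τ : ℝ | ∀ x, 0 ≤ (agg S + τ • agg v) x} ∈ 𝓝 (0 : ℝ) := by
    refine eventually_all.2 fun x => ?_
    have hc : Continuous fun τ : ℝ => (agg S + τ • agg v) x := by
      simp only [PiLp.add_apply, PiLp.smul_apply, smul_eq_mul]
      fun_prop
    exact (hc.tendsto 0 |>.eventually_const_lt (by simpa using hagg x)).mono fun τ hτ => hτ.le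
  have h2 := (hasDerivWithinAt_potential hP Q hn (d := agg v) (fun x => (hagg x).le)
    fun τ hτ => hτ).hasDerivAt h1
  have h3 : ∀ i, HasDerivAt (fun τ : ℝ => ‖(S i - symm S i) + τ • (v i - symm v i)‖ ^ 2)
      (2 * ⟪S i - symm S i, v i - symm v i⟫) 0 := fun i => by
    have h4 := ((hasDerivAt_id (0 : ℝ)).smul_const (v i - symm v i)).const_add (S i - symm S i)
    simpa using h4.norm_sq
  have h5 : (fun τ : ℝ => lyapunov g T (S + τ • v)) = fun τ =>
      (potential g n (agg T) - potential g n (agg S + τ • agg v)) +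
        ∑ i, ‖(S i - symm S i) + τ • (v i - symm v i)‖ ^ 2 := by
    funext τ
    unfold lyapunov
    simp only [symm, agg_add_smul]
    congr 1
    refine Finset.sum_congr rfl fun i _ => ?_
    congr 2
    simp only [Pi.add_apply, Pi.smul_apply]
    module
  unfold HasLineDerivAt
  rw [h5, ← sum_inner_symm hn, Finset.mul_sum]
  exact (h2.const_sub _).add (HasDerivAt.fun_sum fun i _ => h3 i)

/-- At an interior profile the tangent cone is the whole zero-sum hyperplane, so the projection
error is orthogonal to `z`. -/
theorem inner_velocity {S : Profile n m} (hS : S ∈ profiles n m) (hpos : ∀ i x, 0 < S i x)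
    (i : Fin n) {z : Strat m} (hz : ∑ x, z x = 0) :
    ⟪velocity g S i, z⟫ = ⟪gradPayoff g i S, z⟫ := by
  have hmem : ∀ w : Strat m, ∑ x, w x = 0 → w ∈ tangentCone (S i) := fun w hw =>
    (mem_tangentCone_iff (hS i) w).2 ⟨hw, fun x hx => absurd hx (hpos i x).ne'⟩
  have h1 := inner_sub_proj_nonpos (hS i) (hmem z hz) (gradPayoff g i S)
  have h2 := inner_sub_proj_nonpos (hS i) (hmem (-z) (by simp [hz])) (gradPayoff g i S)
  rw [inner_neg_right] at h2
  rw [inner_sub_left] at h1 h2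
  unfold velocity
  linarith

/-- The aggregate velocity `w` is `n` times the zero-sum part of the potential gradient, so the
potential rises at rate `‖w‖² / n`. If `agg S ≠ s` then `w ≠ 0`, because it pairs negatively with
`agg S - s`; otherwise some firm deviates from the average and the response term is strictly
negative. -/
theorem lyapunov_decreasing (hg : g.Standing) (hP : ∀ x, Production (g.u x))
    (Q : QuadraticForm g.c) (hn : 0 < n) {s : Strat m} (hs : s ∈ aggregates n m)
    (hmax : IsMaxOn (potential g n) (aggregates n m) s) {S : Profile n m}
    (hS : S ∈ profiles n m) (hpos : ∀ i x, 0 < S i x) (hne : S ≠ uniformProfile n s) :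
    ∃ d < 0, HasLineDerivAt ℝ (lyapunov g (uniformProfile n s)) d S (velocity g S) := by
  have hn' : (0 : ℝ) < n := by positivity
  refine ⟨_, ?_, hasLineDerivAt_lyapunov hP Q hn _ _ hpos⟩
  have hsymm : ∀ i, symm S i ∈ simplex m := fun i => agg_mem_aggregates hn hS
  have hdev : ∑ i, ⟪S i - symm S i, velocity g S i⟫ =
      ∑ i, ⟪response Q (agg S) (S i - symm S i), S i - symm S i⟫ := by
    have h1 : ∀ i, ⟪S i - symm S i, velocity g S i⟫ =
        ⟪potentialGrad Q n (agg S), S i - symm S i⟫ +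
          ⟪response Q (agg S) (S i - symm S i), S i - symm S i⟫ := fun i => by
      rw [real_inner_comm, inner_velocity hS hpos i (by simp [(hS i).2, (hsymm i).2]),
        gradPayoff_eq_response hP Q hS, inner_add_left]
    rw [Finset.sum_congr rfl fun i _ => h1 i, Finset.sum_add_distrib, ← inner_sum,
      sum_deviation hn, inner_zero_right, zero_add]
  have hgrad : ∀ z : Strat m, ∑ x, z x = 0 →
      ⟪agg (velocity g S), z⟫ = n * ⟪potentialGrad Q n (agg S), z⟫ := fun z hz => by
    rw [agg, sum_inner, Finset.sum_congr rfl fun i _ => inner_velocity hS hpos i hz]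
    simp only [gradPayoff_eq_response hP Q hS, inner_add_left, Finset.sum_add_distrib]
    rw [← sum_inner, ← sum_inner, ← map_sum, sum_deviation hn, map_zero, inner_zero_left, add_zero,
      Finset.sum_const, Finset.card_univ, Fintype.card_fin, ← Nat.cast_smul_eq_nsmul ℝ,
      inner_smul_left]
    simp
  have hvel : ∑ x, agg (velocity g S) x = 0 := by
    simp only [agg_apply]
    rw [Finset.sum_comm]
    exact Finset.sum_eq_zero fun i _ =>
      ((mem_tangentCone_iff (hS i) _).1 (isNearest_proj (hS i) (gradPayoff g i S)).1).1
  have hself := hgrad _ hvel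
  rw [real_inner_self_eq_norm_sq] at hself
  have hresp := fun i => response_nonpos hP Q hg.c_convex hn hS i
  rw [hdev]
  rcases eq_or_ne (agg S) s with h | h
  · obtain ⟨i, hi⟩ := exists_ne_symm h hne
    have h2 := Finset.sum_lt_sum (fun i _ => hresp i)
      ⟨i, Finset.mem_univ i, response_neg hg hP Q hn hS hi⟩
    rw [Finset.sum_const_zero] at h2
    have h3 : 0 ≤ ⟪potentialGrad Q n (agg S), agg (velocity g S)⟫ :=
      nonneg_of_mul_nonneg_right (hself ▸ sq_nonneg _) hn'
    linarith
  · have hS' := agg_mem_aggregates hn hS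
    have h2 := inner_potentialGrad_neg hg hP Q hn hs hmax hS' h
    have h3 := hgrad (agg S - s) (by
      simp [sum_of_mem_aggregates hn hs, sum_of_mem_aggregates hn hS'])
    have h4 : agg (velocity g S) ≠ 0 := fun h0 => by
      rw [h0, inner_zero_left] at h3
      exact (mul_neg_of_pos_of_neg hn' h2).ne h3.symm
    have h5 : 0 < ‖agg (velocity g S)‖ := norm_pos_iff.2 h4
    have h6 : 0 < ⟪potentialGrad Q n (agg S), agg (velocity g S)⟫ :=
      pos_of_mul_pos_right (hself ▸ by positivity) hn'.le
    linarith [Finset.sum_nonpos fun i (_ : i ∈ Finset.univ) => hresp i]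

end Oligopoly

end

theorem mainTheorem2 (n m : ℕ) (hn : 0 < n) (hm : 0 < m) (g : Oligopoly.Market m)
    (hg : g.Standing) (hs : g.Smooth) :
    ∃ Sstar : Oligopoly.Profile n m,
      -- `Sstar` is the unique Nash equilibrium
      (∀ S : Oligopoly.Profile n m, Oligopoly.IsNash g S ↔ S = Sstar) ∧
      Oligopoly.IsGloballyAsymptoticallyStable g Sstar ∧
      -- `V` is continuously differentiable and positive definite on the strategy space
      ContDiffOn ℝ 1 (Oligopoly.lyapunov g Sstar) (Oligopoly.profiles n m) ∧
      Oligopoly.lyapunov g Sstar Sstar = 0 ∧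
      (∀ S ∈ Oligopoly.profiles n m, S ≠ Sstar → 0 < Oligopoly.lyapunov g Sstar S) ∧
      -- `V` has a negative derivative along the process at all other interior profiles
      (∀ S ∈ Oligopoly.profiles n m, (∀ i x, 0 < S i x) → S ≠ Sstar →
        ∃ d < 0, HasLineDerivAt ℝ (Oligopoly.lyapunov g Sstar) d S
          (Oligopoly.velocity g S)) := by
  have hP := hg.production hs
  obtain ⟨Q⟩ := hs.nonempty_quadraticForm
  obtain ⟨s, hmem, hmax⟩ := Oligopoly.exists_isMaxOn_potential hP Q hn hm
  obtain ⟨hstable, hattractive⟩ := Oligopoly.stable_of_drift_neg hP Q hn hmem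
    fun S hS hne => Oligopoly.drift_neg hg hP Q hn hmem hmax hS hne
  exact ⟨Oligopoly.uniformProfile n s,
    Oligopoly.isNash_iff hg hP Q hn hmem hmax,
    ⟨Oligopoly.uniformProfile_mem hmem, fun S₀ hS₀ => Oligopoly.exists_trajectory hP Q hm hS₀,
      hstable, hattractive⟩,
    Oligopoly.contDiffOn_lyapunov hP Q _,
    Oligopoly.lyapunov_uniformProfile hn s,
    fun S hS hne => Oligopoly.lyapunov_pos hg hP Q hn hmem hmax hS hne,
    fun S hS hpos hne => Oligopoly.lyapunov_decreasing hg hP Q hn hmem hmax hS hpos hne⟩
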